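/- **Setting.** Let $X$ be a measurable space and let $C$ be a class of measurable concepts $c:X\to\{0,1\}$. Assume that $C$ is separable for pointwise convergence, i.e. there is a countable $C_0\subseteq C$ such that every $c\in C$ agrees on each finite subset of $X$ with some $c_0\in C_0$. (This holds for every class $C$ when $X$ is countable.) Learners are randomized and may output any (suitably measurable) hypotheses $h:X\to\{0,1\}$, not necessarily in $C$. For a probability distribution $\mu$ on $X$ let $\mathrm{error}_\mu(c,h)=\Pr_{x\sim\mu}[h(x)\ne c(x)]$. $\mathrm{VC}(C)\in\{0,1,\dots,\infty\}$ is the VC dimension. A randomized algorithm $A$ on databases of size $n$ is *$(\varepsilon,\delta)$-differentially private* if $\Pr[A(S)\in F]\le e^{\varepsilon}\Pr[A(S')\in F]+\delta$ for all databases $S,S'$ that differ in exactly one entry and all measurable sets $F$ of outputs. *PSSL.* An $(\alpha,\beta,\varepsilon,\delta,n,m)$-PSSL (private semi-supervised learner) for $C$ is an $(\varepsilon,\delta)$-differentially private algorithm $A$ on databases in $(X\times\{0,1,\bot\})^n$ such that for every $c\in C$ and every distribution $\mu$ on $X$: if the points $x_1,\dots,x_n$ are i.i.d. from $\mu$, the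 first $m$ of them are labeled by $c$ and the others are labeled $\bot$, then with probability at least $1-\beta$ (over the sample and the coins of $A$) the output $h$ satisfies $\mathrm{error}_\mu(c,h)\le\alpha$. *PAL.* An $(\alpha,\beta,\varepsilon,\delta,n,m)$-PAL (private active learner in the sense of Balcan and Feldman) for $C$ is an interactive randomized algorithm that holds an unlabeled pool $x_1,\dots,x_n\in X$, for at most $m$ adaptive rounds outputs an index $i\in\{1,\dots,n\}$ and receives a label $y_i\in\{0,1\}$, and then outputs a hypothesis $h$, such that (i) for every $c\in C$ and every distribution $\mu$ on $X$, if the $x_i$ are i.i.d. from $\mu$ and every query $i$ is answered by $c(x_i)$, then $\Pr[\mathrm{error}_\mu(c,h)\le\alpha]\ge 1-\beta$; and (ii) the output $h$, as a randomized function of the fully labeled sample $(x_i,y_i)_{i=1}^n\in(X\times\{0,1\})^n$, is $(\varepsilon,\delta)$-differentially private. **Theorem.** There are absolute constants $\lambda,a,b>0$ such that for all such $X$ and $C$, all $\alpha,\beta,\varepsilon\in(0,1]$, all $\delta\ge 0$ and all $n\in\mathbb N$: if there exists an $(\alpha,\beta,1,\delta,n,n)$-PSSL for $C$, then there exists a $(\lambda\alpha,\lambda\beta,\varepsilon,\delta,N,m)$-PAL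 for $C$ with $$N\le a\,\frac{n}{\varepsilon}\qquad\text{and}\qquad m\le \frac{b}{\alpha}\,\mathrm{VC}(C)\,\log\frac{1}{\alpha\beta}$$ (where $0\cdot\infty=0$). In particular the bound on the labeled sample complexity $m$ does not depend on the privacy parameters $\varepsilon$ and $\delta$. -/

import Mathlib

open MeasureTheory ProbabilityTheory
open scoped ENNReal

universe u v

/-- Labels `0`, `1` and `⊥` (the last one written `none`), with the discrete σ-algebra. -/
instance instMeasurableSpaceOptionBool : MeasurableSpace (Option Bool) := ⊤

/-- Query symbols: an index of the pool, or `none` for "no query in this round". -/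
instance instMeasurableSpaceOptionFin (n : ℕ) : MeasurableSpace (Option (Fin n)) := ⊤

/-! ### The VC dimension -/

/-- `C` realizes every dichotomy of the finite set `B`. -/
def ShatteredBy {X : Type u} (C : Set (X → Bool)) (B : Finset X) : Prop :=
  ∀ f : X → Bool, ∃ c ∈ C, ∀ x ∈ B, c x = f x

/-- The largest cardinality of a shattered set, `⊤` if these cardinalities are unbounded. -/
noncomputable def vcDimension {X : Type u} (C : Set (X → Bool)) : ℕ∞ :=
  ⨆ (B : Finset X) (_ : ShatteredBy C B), (B.card : ℕ∞)

/-! ### Hypotheses and their error -/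

/-- A set of possible outputs of a learner: a measurable space whose points are (descriptions of)
hypotheses `X → {0,1}`, such that evaluation of a hypothesis at a point is jointly measurable.
The hypotheses need not belong to the concept class (improper learning). -/
structure HypothesisSpace (X : Type u) [MeasurableSpace X] : Type (max u (v + 1)) where
  carrier : Type v
  [measurableSpaceCarrier : MeasurableSpace carrier]
  eval : carrier → X → Bool
  measurable_eval : Measurable fun p : carrier × X => eval p.1 p.2

attribute [instance] HypothesisSpace.measurableSpaceCarrier

/-- The generalization error `Pr_{x ∼ μ} [h x ≠ c x]`. -/
noncomputable def genError {X : Type u} [MeasurableSpace X] (μ : Measure X)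
    (c h : X → Bool) : ℝ :=
  μ.real {x | h x ≠ c x}

/-! ### Differential privacy -/

/-- Databases that differ in exactly one entry. -/
def Neighboring {n : ℕ} {Z : Type*} (S S' : Fin n → Z) : Prop :=
  ∃! i, S i ≠ S' i

/-- `(ε, δ)`-differential privacy of a randomized algorithm on databases of size `n`. -/
def IsDifferentiallyPrivate {n : ℕ} {Z R : Type*} [MeasurableSpace Z] [MeasurableSpace R]
    (A : Kernel (Fin n → Z) R) (ε δ : ℝ) : Prop :=
  ∀ S S' : Fin n → Z, Neighboring S S' → ∀ F : Set R, MeasurableSet F →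
    A S F ≤ ENNReal.ofReal (Real.exp ε) * A S' F + ENNReal.ofReal δ

/-! ### Semi-supervised learners -/

/-- The database whose first `m` entries are labeled by `c` and whose other entries carry `⊥`. -/
def partiallyLabeled {X : Type u} {n : ℕ} (m : ℕ) (c : X → Bool) (D : Fin n → X) :
    Fin n → X × Option Bool :=
  fun i => (D i, if (i : ℕ) < m then some (c (D i)) else none)

/-- `A` is an `(α, β, n, m)`-semi-supervised learner for `C`: for every target concept and every
distribution, over the i.i.d. sample and the coins of `A`, the probability of an output with error
more than `α` is at most `β`. -/
def IsSSL {X : Type u} [MeasurableSpace X] (C : Set (X → Bool)) {H : HypothesisSpace.{u, v} X}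
    {n : ℕ} (A : Kernel (Fin n → X × Option Bool) H.carrier) (α β : ℝ) (m : ℕ) : Prop :=
  ∀ c ∈ C, ∀ μ : Measure X, IsProbabilityMeasure μ →
    ∫⁻ D, A (partiallyLabeled m c D) {r | α < genError μ c (H.eval r)}
      ∂(Measure.pi fun _ : Fin n => μ) ≤ ENNReal.ofReal β

/-- There is an `(α, β, ε, δ, n, m)`-PSSL (private semi-supervised learner) for `C`. -/
def ExistsPSSL {X : Type u} [MeasurableSpace X] (C : Set (X → Bool))
    (α β ε δ : ℝ) (n m : ℕ) : Prop :=
  ∃ (H : HypothesisSpace.{u, v} X) (A : Kernel (Fin n → X × Option Bool) H.carrier),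
    IsMarkovKernel A ∧ IsSSL C A α β m ∧ IsDifferentiallyPrivate A ε δ

/-! ### Active learners -/

/-- An interactive randomized algorithm with a pool of `n` unlabeled examples. It draws its initial
state from the pool only. In each round its current state determines an index to be labeled (or
`none`: no query), and it draws its next state from the current state and the answer. After the last
round it draws a hypothesis from its state. -/
structure ActiveAlgorithm (X : Type u) [MeasurableSpace X] (H : HypothesisSpace.{u, v} X)
    (n : ℕ) : Type (max (u + 1) v) where
  State : Type u
  [measurableSpaceState : MeasurableSpace State]
  init : Kernel (Fin n → X) State
  query : State → Option (Fin n)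
  step : Kernel (State × Option Bool) State
  output : Kernel State H.carrier
  measurable_query : Measurable query
  markov_init : IsMarkovKernel init
  markov_step : IsMarkovKernel step
  markov_output : IsMarkovKernel output

attribute [instance] ActiveAlgorithm.measurableSpaceState ActiveAlgorithm.markov_init
  ActiveAlgorithm.markov_step ActiveAlgorithm.markov_output

namespace ActiveAlgorithm

variable {X : Type u} [MeasurableSpace X] {H : HypothesisSpace.{u, v} X} {n : ℕ}

/-- The answer that the query made in a state receives on a labeled sample. -/
def answer (A : ActiveAlgorithm X H n) (p : (Fin n → X × Bool) × A.State) : Option Bool :=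
  (A.query p.2).map fun i => (p.1 i).2

theorem measurable_answer (A : ActiveAlgorithm X H n) : Measurable A.answer := by
  have h : Measurable fun p : ((Fin n → X × Bool) × A.State) =>
      (A.query p.2, fun i => (p.1 i).2) := by
    refine (A.measurable_query.comp measurable_snd).prodMk (measurable_pi_lambda _ fun i => ?_)
    exact ((measurable_pi_apply i).comp measurable_fst).snd
  have : DiscreteMeasurableSpace (Option (Fin n)) := ⟨fun _ => trivial⟩
  have h' : Measurable fun q : Option (Fin n) × (Fin n → Bool) => q.1.map q.2 :=
    measurable_of_countable _
  exact h'.comp h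

/-- The law of the state after `k` rounds, on a labeled sample of which the algorithm sees the
unlabeled part and the answers to its queries. -/
noncomputable def stateAfter (A : ActiveAlgorithm X H n) :
    ℕ → Kernel (Fin n → X × Bool) A.State
  | 0 => A.init.comap (fun S i => (S i).1)
      (measurable_pi_lambda _ fun i => (measurable_pi_apply i).fst)
  | k + 1 => (A.step.comap (fun p => (p.2, A.answer p))
      (measurable_snd.prodMk A.measurable_answer)) ∘ₖ (Kernel.id ×ₖ stateAfter A k)

/-- The law of the output after `m` rounds, as a function of the fully labeled sample. -/
noncomputable def run (A : ActiveAlgorithm X H n) (m : ℕ) :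
    Kernel (Fin n → X × Bool) H.carrier :=
  A.output ∘ₖ A.stateAfter m

/-- `A`, stopped after `m` rounds, is an `(α, β, n, m)`-active learner for `C`. -/
def IsActiveLearner (A : ActiveAlgorithm X H n) (C : Set (X → Bool)) (α β : ℝ) (m : ℕ) : Prop :=
  ∀ c ∈ C, ∀ μ : Measure X, IsProbabilityMeasure μ →
    ENNReal.ofReal (1 - β) ≤
      ∫⁻ D, A.run m (fun i => (D i, c (D i))) {r | genError μ c (H.eval r) ≤ α}
        ∂(Measure.pi fun _ : Fin n => μ)

end ActiveAlgorithm

/-- There is an `(α, β, ε, δ, n, m)`-PAL (private active learner) for `C`: privacy is that of the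
output as a function of the fully labeled sample, of which at most `m` labels are queried. -/
def ExistsPAL {X : Type u} [MeasurableSpace X] (C : Set (X → Bool))
    (α β ε δ : ℝ) (n m : ℕ) : Prop :=
  ∃ (H : HypothesisSpace.{u, v} X) (A : ActiveAlgorithm X H n),
    A.IsActiveLearner C α β m ∧ IsDifferentiallyPrivate (A.run m) ε δ

/-! A labeled pool of `m` examples, with `m` independent of `n`, is inflated to a pool of between `2
n` and `8 n` examples, on which the given learner `A` can work. One inflation step (`gibbsStep`)
takes a labeled pool and an unlabeled one four times as large, and draws a dichotomy of their union
among those realized by `C`, with probability proportional to 2^(-number of given labels it gets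
wrong). Its values label the larger pool. Only the first pool consumes true labels.

Accuracy. Pool `i` has `4 ^ i * m` examples and its step tolerates `2 ^ i * s` disagreements, where
`s ≤ α m` and `s` is of order `d L`, `L = log (1 / (α β))`. The previous labeling has weight 1, so
dichotomies with more disagreements have total probability at most growth function times 2^(-2^i s).
Concepts with fewer disagreements are `8 α / 2 ^ i`-close to the previous one, by a uniform
deviation bound for disagreement sets (`exists_pair_deviation_set`). Errors and failure
probabilities form geometric series. Because each step only quadruples the pool, the growth function
at step `i` is exp(O(d (i + L))), which 2^(-2^i s) beats; a single jump to size `n` would force `s`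
to grow like `d log n`. The new labels depend on all the points, so accuracy is required
simultaneously for all concepts near the target (`AvoidsNear`).

On the last pool `A` receives `n` uniform draws. Its guarantee for the empirical distribution of the
pool bounds its error on the whole pool. The output need not lie in `C`, so it generalizes for
another reason: at least half of the pool is not drawn, and is independent of the output once the
drawn points and their labels are fixed. A union bound over the realized labelings of both parts
finishes (`avoidsNear_resample`).

Privacy. Moving one point alters the realized dichotomies in one coordinate only, so a Gibbs average
changes by a factor at most 16. A labeled example acts only through the weights of one step; an
unlabeled one acts through the weights of one step and as a single labeled example of the next. The
factors therefore do not multiply along the chain: the total is `16 * 21`, with 21 coming from the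
resampling. Finally every example of the mechanism is picked among `b = O(1 / ε)` candidates; a
changed entry is rarely picked, which reduces the factor to `1 + ε` and `21 δ` to at most `δ`
(`existsPAL_of_mechanism`). -/

set_option linter.unusedSectionVars false

/-! ### Uniform averages over finite types -/

/-- The average of a function over a finite type. -/
noncomputable def uniformAverage {ι : Type*} [Fintype ι] (f : ι → ℝ≥0∞) : ℝ≥0∞ :=
  (Fintype.card ι : ℝ≥0∞)⁻¹ * ∑ i, f i

theorem uniformAverage_mono {ι : Type*} [Fintype ι] {f g : ι → ℝ≥0∞} (h : ∀ i, f i ≤ g i) :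
    uniformAverage f ≤ uniformAverage g :=
  mul_le_mul_right (Finset.sum_le_sum fun i _ => h i) _

theorem uniformAverage_const {ι : Type*} [Fintype ι] [Nonempty ι] (a : ℝ≥0∞) :
    uniformAverage (fun _ : ι => a) = a := by
  rw [uniformAverage, Finset.sum_const, Finset.card_univ, nsmul_eq_mul, ← mul_assoc,
    ENNReal.inv_mul_cancel (by simp) (by simp), one_mul]

theorem uniformAverage_add {ι : Type*} [Fintype ι] (f g : ι → ℝ≥0∞) :
    uniformAverage (fun i => f i + g i) = uniformAverage f + uniformAverage g := by
  simp only [uniformAverage, Finset.sum_add_distrib, mul_add]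

theorem uniformAverage_le {ι : Type*} [Fintype ι] [Nonempty ι] {f : ι → ℝ≥0∞} {a : ℝ≥0∞}
    (h : ∀ i, f i ≤ a) : uniformAverage f ≤ a :=
  (uniformAverage_mono h).trans_eq (uniformAverage_const a)

/-- The term at `i` is charged to the others: averaging the hypothesis over all `j ≠ i` costs a
factor `Λ / (card β - 1) ≤ κ`. The summand `δ` appears once, hence is divided by `card β` in the
average. -/
theorem sum_le_sum_of_forall_ne {Z β : Type*} [Fintype β] {φ : Z → ℝ≥0∞} {z z' : β → Z} {i : β}
    (hz : ∀ j ≠ i, z j = z' j) {Λ δ κ : ℝ≥0∞} (hφ : ∀ j ≠ i, φ (z i) ≤ Λ * φ (z' j) + δ)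
    (hβ : 2 ≤ Fintype.card β) (hκ : Λ ≤ κ * (Fintype.card β - 1 : ℕ)) :
    ∑ j, φ (z j) ≤ (1 + κ) * ∑ j, φ (z' j) + δ := by
  classical
  set c := Fintype.card β - 1 with hc
  have hcard : (Finset.univ.erase i).card = c := by
    rw [Finset.card_erase_of_mem (Finset.mem_univ i), Finset.card_univ]
  have hc0 : (c : ℝ≥0∞) ≠ 0 := by
    have : c ≠ 0 := by omega
    exact_mod_cast this
  have hi : φ (z i) ≤ κ * ∑ j, φ (z' j) + δ := by
    have h1 : (c : ℝ≥0∞) * φ (z i) ≤ c * (κ * ∑ j, φ (z' j) + δ) := by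
      calc (c : ℝ≥0∞) * φ (z i) = ∑ j ∈ Finset.univ.erase i, φ (z i) := by
            rw [Finset.sum_const, hcard, nsmul_eq_mul]
        _ ≤ ∑ j ∈ Finset.univ.erase i, (Λ * φ (z' j) + δ) :=
            Finset.sum_le_sum fun j hj => hφ j (Finset.ne_of_mem_erase hj)
        _ = Λ * ∑ j ∈ Finset.univ.erase i, φ (z' j) + c * δ := by
            rw [Finset.sum_add_distrib, Finset.sum_const, hcard, nsmul_eq_mul, Finset.mul_sum]
        _ ≤ (κ * c) * ∑ j, φ (z' j) + c * δ := by
            gcongr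
            exact Finset.erase_subset _ _
        _ = c * (κ * ∑ j, φ (z' j) + δ) := by ring
    exact (ENNReal.mul_le_mul_iff_right hc0 (ENNReal.natCast_ne_top c)).1 h1
  calc ∑ j, φ (z j) = φ (z i) + ∑ j ∈ Finset.univ.erase i, φ (z j) :=
        (Finset.add_sum_erase _ _ (Finset.mem_univ i)).symm
    _ = φ (z i) + ∑ j ∈ Finset.univ.erase i, φ (z' j) := by
        congr 1
        exact Finset.sum_congr rfl fun j hj => by rw [hz j (Finset.ne_of_mem_erase hj)]
    _ ≤ (κ * ∑ j, φ (z' j) + δ) + ∑ j, φ (z' j) := by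
        gcongr
        exact Finset.erase_subset _ _
    _ = (1 + κ) * ∑ j, φ (z' j) + δ := by ring

/-- `Φ` changes by at most a factor `Λ` and a summand `δ` when one entry of its argument changes. -/
def OneEntryStable {ι Z : Type*} (Φ : (ι → Z) → ℝ≥0∞) (Λ δ : ℝ≥0∞) : Prop :=
  ∀ (a b : ι → Z) (t : ι), (∀ t' ≠ t, a t' = b t') → Φ a ≤ Λ * Φ b + δ

/-- Amplification by sampling: with the other coordinates of `J` frozen, only the choice in
coordinate `t` can meet the changed candidate, and `sum_le_sum_of_forall_ne` applies. -/
theorem uniformAverage_pi_le_of_eq_off {ι Z β : Type*} [Fintype ι] [DecidableEq ι] [Fintype β]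
    {Φ : (ι → Z) → ℝ≥0∞} {Λ δ κ : ℝ≥0∞} (hΦ : OneEntryStable Φ Λ δ)
    (hβ : 2 ≤ Fintype.card β) (hκ : Λ ≤ κ * (Fintype.card β - 1 : ℕ))
    (z z' : ι → β → Z) (t : ι) (i : β) (hz : ∀ t' j, (t' ≠ t ∨ j ≠ i) → z t' j = z' t' j) :
    uniformAverage (fun J : ι → β => Φ fun s => z s (J s)) ≤
      (1 + κ) * uniformAverage (fun J : ι → β => Φ fun s => z' s (J s)) +
        δ * (Fintype.card β : ℝ≥0∞)⁻¹ := by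
  have hsplit : ∀ y : ι → β → Z, ∑ J : ι → β, Φ (fun s => y s (J s)) =
      ∑ r : {s // s ≠ t} → β, ∑ j, Φ (fun s => if h : s = t then y t j else y s (r ⟨s, h⟩)) := by
    intro y
    rw [← (Equiv.funSplitAt t β).symm.sum_comp, Fintype.sum_prod_type, Finset.sum_comm]
    refine Finset.sum_congr rfl fun r _ => Finset.sum_congr rfl fun j _ => ?_
    congr 1
    funext s
    by_cases h : s = t
    · subst h; simp
    · simp [h]
  have hcard : (Fintype.card (ι → β) : ℝ≥0∞) =
      Fintype.card ({s // s ≠ t} → β) * Fintype.card β := by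
    have := Fintype.card_congr (Equiv.funSplitAt t β)
    rw [this, Fintype.card_prod, Nat.cast_mul, mul_comm]
  have hβ0 : (Fintype.card β : ℝ≥0∞) ≠ 0 := by
    have : Fintype.card β ≠ 0 := by omega
    exact_mod_cast this
  have : Nonempty β := Fintype.card_pos_iff.1 (by omega)
  have hmain : ∑ J : ι → β, Φ (fun s => z s (J s)) ≤
      (1 + κ) * ∑ J : ι → β, Φ (fun s => z' s (J s)) +
        Fintype.card ({s // s ≠ t} → β) * δ := by
    rw [hsplit z, hsplit z', Finset.mul_sum]
    have : (Fintype.card ({s // s ≠ t} → β) : ℝ≥0∞) * δ = ∑ r : {s // s ≠ t} → β, δ := by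
      rw [Finset.sum_const, Finset.card_univ, nsmul_eq_mul]
    rw [this, ← Finset.sum_add_distrib]
    refine Finset.sum_le_sum fun r _ => ?_
    have hrw : ∀ j, (fun s => if h : s = t then z t j else z s (r ⟨s, h⟩)) =
        (fun s => if h : s = t then z t j else z' s (r ⟨s, h⟩)) := by
      intro j
      funext s
      split_ifs with h
      · rfl
      · exact hz s _ (Or.inl h)
    simp only [hrw]
    exact sum_le_sum_of_forall_ne (z := z t) (z' := z' t) (i := i)
      (φ := fun x => Φ (fun s => if h : s = t then x else z' s (r ⟨s, h⟩)))
      (fun j hj => hz t j (Or.inr hj))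
      (fun j _ => hΦ _ _ t fun s hs => by simp [hs]) hβ hκ
  calc uniformAverage (fun J : ι → β => Φ fun s => z s (J s))
      ≤ (Fintype.card (ι → β) : ℝ≥0∞)⁻¹ * ((1 + κ) * ∑ J : ι → β, Φ (fun s => z' s (J s)) +
        Fintype.card ({s // s ≠ t} → β) * δ) := mul_le_mul_right hmain _
    _ = (1 + κ) * uniformAverage (fun J : ι → β => Φ fun s => z' s (J s)) +
        (Fintype.card (ι → β) : ℝ≥0∞)⁻¹ * (Fintype.card ({s // s ≠ t} → β) * δ) := by
        rw [uniformAverage, mul_add]; ring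
    _ = _ := by
        congr 1
        rw [hcard, ENNReal.mul_inv (Or.inr (by simp)) (Or.inl (by simp)), mul_comm δ, mul_mul_mul_comm,
          ENNReal.inv_mul_cancel (by simp) (by simp), one_mul]

/-- Here all coordinates draw from one pool, so the changed entry may be drawn repeatedly. A hybrid
argument replaces the pool in one coordinate at a time. -/
theorem uniformAverage_pi_le_pow {ι Z β : Type*} [Fintype ι] [DecidableEq ι] [Fintype β]
    {Φ : (ι → Z) → ℝ≥0∞} {Λ δ κ : ℝ≥0∞} (hΦ : OneEntryStable Φ Λ δ)
    (hβ : 2 ≤ Fintype.card β) (hκ : Λ ≤ κ * (Fintype.card β - 1 : ℕ))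
    (z z' : β → Z) (i : β) (hz : ∀ j ≠ i, z j = z' j) :
    uniformAverage (fun J : ι → β => Φ fun s => z (J s)) ≤
      (1 + κ) ^ Fintype.card ι * uniformAverage (fun J : ι → β => Φ fun s => z' (J s)) +
        Fintype.card ι * (1 + κ) ^ Fintype.card ι * (δ * (Fintype.card β : ℝ≥0∞)⁻¹) := by
  set D := δ * (Fintype.card β : ℝ≥0∞)⁻¹
  -- `T` is the set of coordinates that already draw from `z'`.
  have key : ∀ T : Finset ι, uniformAverage (fun J : ι → β => Φ fun s => z (J s)) ≤
      (1 + κ) ^ T.card * uniformAverage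
        (fun J : ι → β => Φ fun s => (if s ∈ T then z' else z) (J s)) +
        T.card * (1 + κ) ^ T.card * D := by
    intro T
    induction T using Finset.induction_on with
    | empty => simp
    | insert a T ha ih =>
      have hstep := uniformAverage_pi_le_of_eq_off hΦ hβ hκ
        (fun s => if s ∈ T then z' else z) (fun s => if s ∈ insert a T then z' else z) a i (by
          rintro t' j (h | h)
          · simp [h]
          · by_cases h1 : t' ∈ T
            · simp [h1]
            · by_cases h2 : t' = a
              · subst h2; simp [h1, hz j h]
              · simp [h1, h2])
      refine ih.trans ?_
      rw [Finset.card_insert_of_notMem ha]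
      set V := uniformAverage
        (fun J : ι → β => Φ fun s => (if s ∈ insert a T then z' else z) (J s))
      calc _ ≤ (1 + κ) ^ T.card * ((1 + κ) * V + D) + T.card * (1 + κ) ^ T.card * D := by gcongr
        _ = (1 + κ) ^ (T.card + 1) * V + (1 + T.card) * (1 + κ) ^ T.card * D := by ring
        _ ≤ (1 + κ) ^ (T.card + 1) * V + (1 + T.card) * (1 + κ) ^ (T.card + 1) * D := by
            gcongr
            · exact le_self_add
            · exact Nat.le_succ _
        _ = _ := by push_cast; ring
  simpa using key Finset.univ

/-! ### Dichotomies realized by a concept class -/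

section Realizes

variable {X : Type u} {ι : Type*}

/-- Some concept of `C` labels the points `T` by `g`. -/
def Realizes (C : Set (X → Bool)) (T : ι → X) (g : ι → Bool) : Prop :=
  ∃ c ∈ C, ∀ i, c (T i) = g i

theorem exists_countable_subclass {C : Set (X → Bool)} (hC : TopologicalSpace.SeparableSpace C) :
    ∃ C₀ ⊆ C, C₀.Countable ∧ ∀ c ∈ C, ∀ F : Finset X, ∃ c₀ ∈ C₀, ∀ x ∈ F, c₀ x = c x := by
  obtain ⟨s, hs, hd⟩ := hC.exists_countable_dense
  refine ⟨Subtype.val '' s, by rintro _ ⟨c, _, rfl⟩; exact c.2, hs.image _, fun c hc F => ?_⟩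
  have hopen : IsOpen {d : C | ∀ x ∈ F, d.1 x = c x} := by
    have : {d : C | ∀ x ∈ F, d.1 x = c x} = ⋂ x ∈ F, {d : C | d.1 x = c x} := by ext; simp
    rw [this]
    refine isOpen_biInter_finset fun x _ => ?_
    have hcont : Continuous fun d : C => d.1 x :=
      (continuous_apply x).comp continuous_subtype_val
    exact (isOpen_discrete ({c x} : Set Bool)).preimage hcont
  obtain ⟨d, hd1, hd2⟩ := hd.exists_mem_open hopen ⟨⟨c, hc⟩, fun _ _ => rfl⟩
  exact ⟨d.1, ⟨d, hd1, rfl⟩, hd2⟩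

/-- Realizing a labeling of finitely many points involves finitely many values of a concept, so the
union over `C` can be taken over a countable subclass. All uses of separability go through this set.
-/
theorem measurableSet_realizes [MeasurableSpace X] [Finite ι] {C : Set (X → Bool)}
    (hm : ∀ c ∈ C, Measurable c) (hC : TopologicalSpace.SeparableSpace C) (g : ι → Bool) :
    MeasurableSet {T : ι → X | Realizes C T g} := by
  classical
  cases nonempty_fintype ι
  obtain ⟨C₀, hsub, hcount, happrox⟩ := exists_countable_subclass hC
  have : {T : ι → X | Realizes C T g} = ⋃ c ∈ C₀, ⋂ i, {T : ι → X | c (T i) = g i} := by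
    ext T
    simp only [Set.mem_ofPred_eq, Set.mem_iUnion, Set.mem_iInter, exists_prop]
    constructor
    · rintro ⟨c, hc, h⟩
      obtain ⟨c₀, h₀, h₁⟩ := happrox c hc (Finset.univ.image T)
      exact ⟨c₀, h₀, fun i => (h₁ _ (by simp)).trans (h i)⟩
    · rintro ⟨c, hc, h⟩
      exact ⟨c, hsub hc, h⟩
  rw [this]
  refine MeasurableSet.biUnion hcount fun c hc => MeasurableSet.iInter fun i => ?_
  exact ((hm c (hsub hc)).comp (measurable_pi_apply i)) (measurableSet_singleton (g i))

theorem Realizes.comp {κ : Type*} {C : Set (X → Bool)} {T : ι → X} {g : ι → Bool}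
    (h : Realizes C T g) (f : κ → ι) : Realizes C (T ∘ f) (g ∘ f) := by
  obtain ⟨c, hc, h⟩ := h
  exact ⟨c, hc, fun i => h (f i)⟩

theorem realizes_comp {C : Set (X → Bool)} {c : X → Bool} (hc : c ∈ C) (T : ι → X) :
    Realizes C T (c ∘ T) :=
  ⟨c, hc, fun _ => rfl⟩

end Realizes

/-! ### Stability of Gibbs averages -/

section GibbsAverage

variable {ι : Type*} [Fintype ι] [DecidableEq ι]

theorem sum_sum_update_bool (F : (ι → Bool) → ℝ≥0∞) (p : ι) :
    ∑ g, ∑ b, F (Function.update g p b) = 2 * ∑ g, F g := by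
  have hsymm : ∀ (b : Bool) (r : {j // j ≠ p} → Bool) (b' : Bool),
      Function.update ((Equiv.funSplitAt p Bool).symm (b, r)) p b' =
        (Equiv.funSplitAt p Bool).symm (b', r) := by
    intro b r b'
    funext s
    by_cases h : s = p
    · subst h; simp
    · simp [h]
  rw [← (Equiv.funSplitAt p Bool).symm.sum_comp,
    ← (Equiv.funSplitAt p Bool).symm.sum_comp (fun g => F g), Fintype.sum_prod_type,
    Fintype.sum_prod_type]
  simp only [hsymm]
  rw [Finset.sum_const, Finset.card_univ, Fintype.card_bool, nsmul_eq_mul, Finset.sum_comm]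
  simp

/-- The two weights live on different sets of dichotomies and are compared only after summation over
the coordinate `p`. Every `g` is an update at `p` of exactly two functions, so each comparison costs
`2 * 2`: once for the numerator, once for the normalization. -/
theorem sum_div_mul_le_of_update {w w' φ φ' : (ι → Bool) → ℝ≥0∞} {p : ι} {A δ : ℝ≥0∞}
    (hw : ∀ g, w g ≤ 2 * ∑ b, w' (Function.update g p b))
    (hw' : ∀ g, w' g ≤ 2 * ∑ b, w (Function.update g p b))
    (hφ : ∀ g b, φ g ≤ A * φ' (Function.update g p b) + δ)
    (h0 : ∑ g, w g ≠ 0) (htop : ∑ g, w g ≠ ∞) :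
    ∑ g, w g / (∑ g, w g) * φ g ≤ 16 * A * ∑ g, w' g / (∑ g, w' g) * φ' g + δ := by
  set Z := ∑ g, w g with hZ
  set Z' := ∑ g, w' g with hZ'
  -- `hφ` holds for both values at `p`, hence with the smaller one; that minimum lies below `φ'` at
  -- whichever update carries the weight `w'`.
  set m : (ι → Bool) → ℝ≥0∞ := fun g =>
    min (φ' (Function.update g p true)) (φ' (Function.update g p false)) with hm
  have hm_le : ∀ g b, m g ≤ φ' (Function.update g p b) := by
    rintro g (_ | _)
    · exact min_le_right _ _
    · exact min_le_left _ _
  have hφm : ∀ g, φ g ≤ A * m g + δ := by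
    intro g
    rcases min_choice (φ' (Function.update g p true)) (φ' (Function.update g p false)) with h | h
    · simp only [hm, h]; exact hφ g true
    · simp only [hm, h]; exact hφ g false
  have hZZ' : Z⁻¹ ≤ 4 * Z'⁻¹ := by
    have h1 : Z' ≤ 4 * Z := by
      calc Z' ≤ ∑ g, 2 * ∑ b, w (Function.update g p b) := Finset.sum_le_sum fun g _ => hw' g
        _ = 4 * Z := by rw [← Finset.mul_sum, sum_sum_update_bool, ← mul_assoc, hZ]; norm_num
    calc Z⁻¹ = 4 * (4 * Z)⁻¹ := by
          rw [ENNReal.mul_inv (by simp) (by simp), ← mul_assoc,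
            ENNReal.mul_inv_cancel (by simp) (by simp), one_mul]
      _ ≤ 4 * Z'⁻¹ := by gcongr
  have hsum : ∑ g, w g * m g ≤ 4 * ∑ g, w' g * φ' g := by
    calc ∑ g, w g * m g ≤ ∑ g, 2 * ∑ b, w' (Function.update g p b) *
          φ' (Function.update g p b) := by
          refine Finset.sum_le_sum fun g _ => ?_
          calc w g * m g ≤ (2 * ∑ b, w' (Function.update g p b)) * m g := by gcongr; exact hw g
            _ = 2 * ∑ b, w' (Function.update g p b) * m g := by rw [mul_assoc, Finset.sum_mul]
            _ ≤ _ := by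
              gcongr with b
              exact hm_le g b
      _ = 4 * ∑ g, w' g * φ' g := by
          rw [← Finset.mul_sum, sum_sum_update_bool (fun g => w' g * φ' g), ← mul_assoc]; norm_num
  calc ∑ g, w g / Z * φ g ≤ ∑ g, w g / Z * (A * m g + δ) := by
        gcongr with g
        exact hφm g
    _ = A * (Z⁻¹ * ∑ g, w g * m g) + (Z⁻¹ * Z) * δ := by
        rw [hZ, Finset.mul_sum, Finset.mul_sum, Finset.mul_sum, Finset.sum_mul,
          ← Finset.sum_add_distrib]
        refine Finset.sum_congr rfl fun g _ => ?_
        rw [div_eq_mul_inv]; ring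
    _ ≤ A * ((4 * Z'⁻¹) * (4 * ∑ g, w' g * φ' g)) + 1 * δ := by
        gcongr
        exact (ENNReal.inv_mul_cancel h0 htop).le
    _ = 16 * A * ∑ g, w' g / Z' * φ' g + δ := by
        have : ∑ g, w' g / Z' * φ' g = Z'⁻¹ * ∑ g, w' g * φ' g := by
          rw [Finset.mul_sum]
          refine Finset.sum_congr rfl fun g _ => ?_
          rw [div_eq_mul_inv]; ring
        rw [this]; ring

end GibbsAverage

/-! ### The exponential mechanism over dichotomies -/

section Gibbs

variable {X : Type u} {ι κ τ : Type*} [Fintype ι] [Fintype κ]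

/-- The number of labels of `S` that `g` gets wrong. -/
def disagreements (S : ι → X × Bool) (g : ι → Bool) : ℕ :=
  (Finset.univ.filter fun i => g i ≠ (S i).2).card

open Classical in
/-- The unnormalized weight of a dichotomy of the points of `S` and `V` in the exponential
mechanism whose score is the number of disagreements with the labels of `S`. -/
noncomputable def gibbsWeight (C : Set (X → Bool)) (S : ι → X × Bool) (V : κ → X)
    (g : ι ⊕ κ → Bool) : ℝ≥0∞ :=
  if Realizes C (Sum.elim (fun i => (S i).1) V) g then
    (2⁻¹ : ℝ≥0∞) ^ disagreements S (g ∘ Sum.inl) else 0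

theorem gibbsWeight_le_one (C : Set (X → Bool)) (S : ι → X × Bool) (V : κ → X)
    (g : ι ⊕ κ → Bool) : gibbsWeight C S V g ≤ 1 := by
  unfold gibbsWeight
  split_ifs
  · exact pow_le_one₀ (by simp) (by simp)
  · simp

theorem sum_gibbsWeight_ne_top [DecidableEq ι] [DecidableEq κ] (C : Set (X → Bool))
    (S : ι → X × Bool) (V : κ → X) :
    ∑ g, gibbsWeight C S V g ≠ ∞ :=
  ENNReal.sum_ne_top.2 fun g _ => ne_top_of_le_ne_top (by simp) (gibbsWeight_le_one C S V g)

theorem sum_gibbsWeight_ne_zero [DecidableEq ι] [DecidableEq κ] {C : Set (X → Bool)}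
    (hC : C.Nonempty) (S : ι → X × Bool) (V : κ → X) :
    ∑ g, gibbsWeight C S V g ≠ 0 := by
  obtain ⟨c, hc⟩ := hC
  intro h
  have := Finset.sum_eq_zero_iff.1 h (c ∘ Sum.elim (fun i => (S i).1) V) (Finset.mem_univ _)
  rw [gibbsWeight, if_pos (realizes_comp hc _)] at this
  exact pow_ne_zero _ (by simp) this

theorem one_le_sum_gibbsWeight [DecidableEq ι] [DecidableEq κ] {C : Set (X → Bool)}
    {c : X → Bool} (hc : c ∈ C) (T : ι → X) (V : κ → X) :
    1 ≤ ∑ g, gibbsWeight C (fun i => (T i, c (T i))) V g := by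
  refine le_trans ?_ (Finset.single_le_sum (fun _ _ => zero_le)
    (Finset.mem_univ (c ∘ Sum.elim T V)))
  rw [gibbsWeight, if_pos (realizes_comp hc _)]
  simp [disagreements]

/-- After the point at `p` has moved, `g` itself may no longer be realized. The concept that
realized it labels the new point in some way; the corresponding update is realized and has at most
one more disagreement. -/
theorem gibbsWeight_le_two_mul_sum [DecidableEq ι] [DecidableEq κ] {C : Set (X → Bool)}
    {S S' : ι → X × Bool} {V V' : κ → X} (p : ι ⊕ κ)
    (hS : ∀ i, Sum.inl i ≠ p → S i = S' i) (hV : ∀ k, Sum.inr k ≠ p → V k = V' k)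
    (g : ι ⊕ κ → Bool) :
    gibbsWeight C S V g ≤ 2 * ∑ b, gibbsWeight C S' V' (Function.update g p b) := by
  by_cases h : Realizes C (Sum.elim (fun i => (S i).1) V) g
  swap
  · simp [gibbsWeight, h]
  rw [gibbsWeight, if_pos h]
  obtain ⟨c, hc, hcg⟩ := h
  set x' := Sum.elim (fun i => (S' i).1) V' p with hx'
  have hreal : Realizes C (Sum.elim (fun i => (S' i).1) V') (Function.update g p (c x')) := by
    refine ⟨c, hc, fun q => ?_⟩
    by_cases hq : q = p
    · subst hq; simp [hx']
    · rw [Function.update_of_ne hq, ← hcg q]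
      rcases q with i | k
      · simp [hS i hq]
      · simp [hV k hq]
  have hdis : disagreements S' ((Function.update g p (c x')) ∘ Sum.inl) ≤
      disagreements S (g ∘ Sum.inl) + 1 := by
    unfold disagreements
    have hsub : (Finset.univ.filter fun i =>
        ((Function.update g p (c x')) ∘ Sum.inl) i ≠ (S' i).2) ⊆
        (Finset.univ.filter fun i => (g ∘ Sum.inl) i ≠ (S i).2) ∪
          Finset.univ.filter fun i => Sum.inl i = p := by
      intro i hi
      simp only [Finset.mem_union, Finset.mem_filter, Finset.mem_univ, true_and] at hi ⊢
      by_cases hp : Sum.inl i = p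
      · exact Or.inr hp
      · left
        rw [hS i hp]
        simpa [Function.update_of_ne hp] using hi
    refine (Finset.card_le_card hsub).trans ((Finset.card_union_le _ _).trans ?_)
    gcongr
    refine Finset.card_le_one.2 fun a ha b hb => ?_
    simp only [Finset.mem_filter, Finset.mem_univ, true_and] at ha hb
    exact Sum.inl_injective (ha.trans hb.symm)
  refine le_trans ?_ (mul_le_mul_right (Finset.single_le_sum
    (f := fun b => gibbsWeight C S' V' (Function.update g p b))
    (fun _ _ => zero_le) (Finset.mem_univ (c x'))) 2)
  rw [gibbsWeight, if_pos hreal]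
  calc (2⁻¹ : ℝ≥0∞) ^ disagreements S (g ∘ Sum.inl)
      = 2 * (2⁻¹ : ℝ≥0∞) ^ (disagreements S (g ∘ Sum.inl) + 1) := by
        rw [pow_succ', ← mul_assoc, ENNReal.mul_inv_cancel (by simp) (by simp), one_mul]
    _ ≤ _ := by
        exact mul_le_mul_right
          (pow_le_pow_of_le_one zero_le (ENNReal.inv_le_one.2 one_le_two) hdis) 2

variable [MeasurableSpace X]

theorem measurable_disagreements (g : ι → Bool) :
    Measurable fun S : ι → X × Bool => disagreements S g := by
  have : (fun S : ι → X × Bool => disagreements S g) =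
      (fun y : ι → Bool => (Finset.univ.filter fun i => g i ≠ y i).card) ∘
        fun S i => (S i).2 := rfl
  rw [this]
  exact (measurable_of_countable _).comp (measurable_pi_lambda _ fun i =>
    (measurable_pi_apply i).snd)

theorem measurable_gibbsWeight {C : Set (X → Bool)} (hm : ∀ c ∈ C, Measurable c)
    (hC : TopologicalSpace.SeparableSpace C) (g : ι ⊕ κ → Bool) :
    Measurable fun q : (ι → X × Bool) × (κ → X) => gibbsWeight C q.1 q.2 g := by
  unfold gibbsWeight
  refine Measurable.ite ?_ ?_ measurable_const
  · have : Measurable fun q : (ι → X × Bool) × (κ → X) =>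
        (Sum.elim (fun i => (q.1 i).1) q.2 : ι ⊕ κ → X) := by
      refine measurable_pi_lambda _ ?_
      rintro (i | k)
      · exact ((measurable_pi_apply i).comp measurable_fst).fst
      · exact (measurable_pi_apply k).comp measurable_snd
    exact this (measurableSet_realizes hm hC g)
  · exact (measurable_of_countable (fun k : ℕ => (2⁻¹ : ℝ≥0∞) ^ k)).comp
      ((measurable_disagreements _).comp measurable_fst)

end Gibbs

/-! ### Mechanisms on a labeled and an unlabeled pool -/

section Mechanism

variable {X : Type u} [MeasurableSpace X] {R : Type v} [MeasurableSpace R]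
variable {ι κ τ : Type*} [Fintype ι] [Fintype κ] [Fintype τ]

/-- Stability of the output law under a change of one labeled example. -/
def LabeledStable (B : Kernel ((ι → X × Bool) × (κ → X)) R) (Λ δ : ℝ≥0∞) : Prop :=
  ∀ (S S' : ι → X × Bool) (U : κ → X) (i : ι), (∀ j ≠ i, S j = S' j) →
    ∀ F : Set R, MeasurableSet F → B (S, U) F ≤ Λ * B (S', U) F + δ

/-- Stability of the output law under a change of one unlabeled example. -/
def UnlabeledStable (B : Kernel ((ι → X × Bool) × (κ → X)) R) (Λ δ : ℝ≥0∞) : Prop :=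
  ∀ (S : ι → X × Bool) (U U' : κ → X) (k : κ), (∀ j ≠ k, U j = U' j) →
    ∀ F : Set R, MeasurableSet F → B (S, U) F ≤ Λ * B (S, U') F + δ

/-- The set `bad` of outputs has expected probability at most `β`, even if the labeled examples
are labeled by an adversarially chosen concept at distance at most `ρ` from `c`. -/
def AvoidsNear (C : Set (X → Bool)) (B : Kernel ((ι → X × Bool) × (κ → X)) R)
    (μ : Measure X) (c : X → Bool) (bad : Set R) (ρ : ℝ) (β : ℝ≥0∞) : Prop :=
  ∃ Ψ : (ι → X) × (κ → X) → ℝ≥0∞, Measurable Ψ ∧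
    (∀ T U, ∀ h ∈ C, genError μ c h ≤ ρ → B (fun i => (T i, h (T i)), U) bad ≤ Ψ (T, U)) ∧
    ∫⁻ q, Ψ q ∂((Measure.pi fun _ : ι => μ).prod (Measure.pi fun _ : κ => μ)) ≤ β

variable [DecidableEq ι] [DecidableEq κ]

/-- The first labeled pool is used to relabel the first part of the unlabeled pool by the
exponential mechanism, and `B` is run on the relabeled part. -/
noncomputable def gibbsStep {C : Set (X → Bool)} (hm : ∀ c ∈ C, Measurable c)
    (hC : TopologicalSpace.SeparableSpace C) (B : Kernel ((κ → X × Bool) × (τ → X)) R) :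
    Kernel ((ι → X × Bool) × (κ ⊕ τ → X)) R where
  toFun q := ∑ g : ι ⊕ κ → Bool,
    (gibbsWeight C q.1 (q.2 ∘ Sum.inl) g / ∑ g', gibbsWeight C q.1 (q.2 ∘ Sum.inl) g') •
      B (fun k => (q.2 (Sum.inl k), g (Sum.inr k)), q.2 ∘ Sum.inr)
  measurable' := by
    have hV : Measurable fun q : (ι → X × Bool) × (κ ⊕ τ → X) => (q.1, q.2 ∘ Sum.inl) :=
      measurable_fst.prodMk (measurable_pi_lambda _ fun k =>
        (measurable_pi_apply _).comp measurable_snd)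
    have hw : ∀ g : ι ⊕ κ → Bool, Measurable fun q : (ι → X × Bool) × (κ ⊕ τ → X) =>
        gibbsWeight C q.1 (q.2 ∘ Sum.inl) g := fun g => (measurable_gibbsWeight hm hC g).comp hV
    refine Measure.measurable_of_measurable_coe _ fun F hF => ?_
    simp only [Measure.coe_finsetSum, Finset.sum_apply, Measure.smul_apply, smul_eq_mul]
    refine Finset.measurable_sum _ fun g _ => ?_
    refine ((hw g).div (Finset.measurable_sum _ fun g' _ => hw g')).mul ?_
    refine (B.measurable_coe hF).comp (Measurable.prodMk (measurable_pi_lambda _ fun k => ?_)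
      (measurable_pi_lambda _ fun k => (measurable_pi_apply _).comp measurable_snd))
    exact ((measurable_pi_apply _).comp measurable_snd).prodMk measurable_const

variable {C : Set (X → Bool)} (hm : ∀ c ∈ C, Measurable c)
  (hC : TopologicalSpace.SeparableSpace C) {B : Kernel ((κ → X × Bool) × (τ → X)) R}

theorem gibbsStep_apply (q : (ι → X × Bool) × (κ ⊕ τ → X)) (F : Set R) :
    gibbsStep hm hC B q F = ∑ g : ι ⊕ κ → Bool,
      gibbsWeight C q.1 (q.2 ∘ Sum.inl) g / (∑ g', gibbsWeight C q.1 (q.2 ∘ Sum.inl) g') *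
        B (fun k => (q.2 (Sum.inl k), g (Sum.inr k)), q.2 ∘ Sum.inr) F := by
  simp [gibbsStep]

theorem sum_gibbsWeight_div (hne : C.Nonempty) (S : ι → X × Bool) (V : κ → X) :
    ∑ g, gibbsWeight C S V g / (∑ g', gibbsWeight C S V g') = 1 := by
  simp only [div_eq_mul_inv]
  rw [← Finset.sum_mul]
  exact ENNReal.mul_inv_cancel (sum_gibbsWeight_ne_zero hne S V) (sum_gibbsWeight_ne_top C S V)

theorem isMarkovKernel_gibbsStep [IsMarkovKernel B] (hne : C.Nonempty) :
    IsMarkovKernel (gibbsStep (ι := ι) hm hC B) := by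
  refine ⟨fun q => ⟨?_⟩⟩
  rw [gibbsStep_apply]
  simp only [measure_univ, mul_one]
  exact sum_gibbsWeight_div hne _ _

/-- Given the dichotomy on the second pool, `B` does not see the first one. The constants are thus
independent of those of `B`, which is what stops the accumulation along the chain. -/
theorem labeledStable_gibbsStep (hne : C.Nonempty) :
    LabeledStable (gibbsStep (ι := ι) hm hC B) 16 0 := by
  intro S S' U i hS F hF
  simp only [gibbsStep_apply]
  have := sum_div_mul_le_of_update (p := (Sum.inl i : ι ⊕ κ)) (A := 1) (δ := 0)
    (w := gibbsWeight C S (U ∘ Sum.inl)) (w' := gibbsWeight C S' (U ∘ Sum.inl))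
    (φ := fun g => B (fun k => (U (Sum.inl k), g (Sum.inr k)), U ∘ Sum.inr) F)
    (φ' := fun g => B (fun k => (U (Sum.inl k), g (Sum.inr k)), U ∘ Sum.inr) F)
    (gibbsWeight_le_two_mul_sum _ (fun j hj => hS j fun h => hj (h ▸ rfl)) fun _ _ => rfl)
    (gibbsWeight_le_two_mul_sum _ (fun j hj => (hS j fun h => hj (h ▸ rfl)).symm) fun _ _ => rfl)
    (fun g b => by simp)
    (sum_gibbsWeight_ne_zero hne _ _) (sum_gibbsWeight_ne_top _ _ _)
  simpa using this

/-- A point of the relabeled pool acts through the Gibbs weights (factor 16) and as one labeled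
example of `B` (factor `Λ`). A point of a later pool acts inside `B` only, and averaging over
dichotomies preserves its bound. So `16 * Λ` reproduces itself. -/
theorem unlabeledStable_gibbsStep (hne : C.Nonempty) {Λ δ : ℝ≥0∞}
    (hL : LabeledStable B Λ δ) (hU : UnlabeledStable B (16 * Λ) δ) :
    UnlabeledStable (gibbsStep (ι := ι) hm hC B) (16 * Λ) δ := by
  rintro S U U' (k | t) hk F hF
  · simp only [gibbsStep_apply]
    have hr : U ∘ Sum.inr = U' ∘ Sum.inr := funext fun t => hk _ (by simp)
    refine sum_div_mul_le_of_update (p := (Sum.inr k : ι ⊕ κ))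
      (w := gibbsWeight C S (U ∘ Sum.inl)) (w' := gibbsWeight C S (U' ∘ Sum.inl))
      (φ := fun g => B (fun k => (U (Sum.inl k), g (Sum.inr k)), U ∘ Sum.inr) F)
      (φ' := fun g => B (fun k => (U' (Sum.inl k), g (Sum.inr k)), U' ∘ Sum.inr) F)
      (gibbsWeight_le_two_mul_sum _ (fun _ _ => rfl) fun j hj => hk _ (by simpa using hj))
      (gibbsWeight_le_two_mul_sum _ (fun _ _ => rfl)
        fun j hj => (hk _ (by simpa using hj)).symm) (fun g b => ?_)
      (sum_gibbsWeight_ne_zero hne _ _) (sum_gibbsWeight_ne_top _ _ _)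
    rw [hr]
    refine hL _ _ _ k (fun j hj => ?_) F hF
    simp [hk (Sum.inl j) (by simpa using hj), hj]
  · simp only [gibbsStep_apply]
    have hl : U ∘ Sum.inl = U' ∘ Sum.inl := funext fun t => hk _ (by simp)
    have hl' : ∀ k, U (Sum.inl k) = U' (Sum.inl k) := fun k => congrFun hl k
    rw [hl]
    simp only [hl']
    calc _ ≤ ∑ g : ι ⊕ κ → Bool, gibbsWeight C S (U' ∘ Sum.inl) g /
          (∑ g', gibbsWeight C S (U' ∘ Sum.inl) g') *
            (16 * Λ * B (fun k => (U' (Sum.inl k), g (Sum.inr k)), U' ∘ Sum.inr) F + δ) := by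
          gcongr with g
          exact hU _ _ _ t (fun j hj => hk _ (by simpa using hj)) F hF
      _ = _ := by
          simp only [mul_add, Finset.sum_add_distrib]
          rw [← Finset.sum_mul, sum_gibbsWeight_div hne, one_mul, Finset.mul_sum]
          congr 1
          exact Finset.sum_congr rfl fun g _ => by ring

theorem genError_triangle {μ : Measure X} [IsFiniteMeasure μ] (c h g : X → Bool) :
    genError μ c g ≤ genError μ c h + genError μ h g := by
  refine (measureReal_mono (s₂ := {x | h x ≠ c x} ∪ {x | g x ≠ h x}) (fun x hx => ?_)).trans
    (measureReal_union_le _ _)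
  simp only [Set.mem_union, Set.mem_ofPred_eq] at hx ⊢
  by_contra! hcon
  exact hx (hcon.2.trans hcon.1)

/-- The dichotomy of `h` makes the normalization at least 1, so each of the at most `G` dichotomies
with more than `s` disagreements has probability at most `2⁻¹ ^ s`. All others come from concepts
covered by `hb`. -/
theorem gibbsStep_le [IsMarkovKernel B] {s : ℕ} {G : ℝ≥0∞}
    (hG : ∀ T : ι ⊕ κ → X, ((Set.toFinite {g | Realizes C T g}).toFinset.card : ℝ≥0∞) ≤ G)
    {h : X → Bool} (hh : h ∈ C) (T : ι → X) (U : κ ⊕ τ → X) {F : Set R} {b : ℝ≥0∞}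
    (hb : ∀ g ∈ C, (Finset.univ.filter fun i => g (T i) ≠ h (T i)).card ≤ s →
      B (fun k => (U (Sum.inl k), g (U (Sum.inl k))), U ∘ Sum.inr) F ≤ b) :
    gibbsStep hm hC B (fun i => (T i, h (T i)), U) F ≤ b + G * 2⁻¹ ^ s := by
  classical
  rw [gibbsStep_apply]
  simp only
  set V := U ∘ Sum.inl
  set S : ι → X × Bool := fun i => (T i, h (T i)) with hS
  set Z := ∑ g', gibbsWeight C S V g' with hZ
  have hZ1 : 1 ≤ Z := one_le_sum_gibbsWeight hh T V
  calc _ ≤ ∑ g : ι ⊕ κ → Bool, (gibbsWeight C S V g / Z * b +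
        if g ∈ (Set.toFinite {g | Realizes C (Sum.elim T V) g}).toFinset
          then 2⁻¹ ^ s else 0) := by
        refine Finset.sum_le_sum fun g _ => ?_
        by_cases hg : Realizes C (Sum.elim T V) g
        swap
        · have : gibbsWeight C S V g = 0 := by rw [gibbsWeight, if_neg hg]
          simp [this]
        simp only [Set.Finite.mem_toFinset, Set.mem_ofPred_eq, if_pos hg]
        by_cases hd : disagreements S (g ∘ Sum.inl) ≤ s
        · refine le_add_right ?_
          gcongr
          obtain ⟨c, hc, hcg⟩ := hg
          have hr : ∀ k, g (Sum.inr k) = c (U (Sum.inl k)) := fun k => (hcg (Sum.inr k)).symm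
          have hl : ∀ i, g (Sum.inl i) = c (T i) := fun k => (hcg (Sum.inl k)).symm
          simp only [hr]
          refine hb c hc ?_
          simpa [disagreements, hl, hS] using hd
        · refine le_add_left ?_
          calc _ ≤ gibbsWeight C S V g / 1 * 1 := by
                gcongr
                exact prob_le_one
            _ = 2⁻¹ ^ disagreements S (g ∘ Sum.inl) := by
                rw [mul_one, div_one, gibbsWeight, if_pos hg]
            _ ≤ _ := pow_le_pow_of_le_one zero_le (ENNReal.inv_le_one.2 one_le_two) (by omega)
    _ = b + (Set.toFinite {g | Realizes C (Sum.elim T V) g}).toFinset.card * 2⁻¹ ^ s := by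
        rw [Finset.sum_add_distrib, ← Finset.sum_mul, sum_gibbsWeight_div ⟨h, hh⟩, one_mul,
          Finset.sum_ite_mem, Finset.univ_inter, Finset.sum_const, nsmul_eq_mul]
    _ ≤ _ := by
        gcongr
        exact hG _

/-- Outside `E`, a concept with few disagreements is within `ρ'` of `h`, hence within `ρ + ρ'` of
`c`. The bound for `B` covers all such concepts at once, so it does not matter that the drawn one
depends on both pools. -/
theorem avoidsNear_gibbsStep [IsMarkovKernel B] {s : ℕ} {G γ β : ℝ≥0∞} {μ : Measure X}
    [IsProbabilityMeasure μ] {c : X → Bool} {bad : Set R} {ρ ρ' : ℝ}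
    (hG : ∀ T : ι ⊕ κ → X, ((Set.toFinite {g | Realizes C T g}).toFinset.card : ℝ≥0∞) ≤ G)
    (hdev : ∃ E : Set (ι → X), MeasurableSet E ∧ (Measure.pi fun _ : ι => μ) E ≤ γ ∧
      ∀ T ∉ E, ∀ g ∈ C, ∀ h ∈ C,
        (Finset.univ.filter fun i => g (T i) ≠ h (T i)).card ≤ s → genError μ h g ≤ ρ')
    (hB : AvoidsNear C B μ c bad (ρ + ρ') β) :
    AvoidsNear C (gibbsStep (ι := ι) hm hC B) μ c bad ρ (γ + G * 2⁻¹ ^ s + β) := by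
  obtain ⟨E, hE, hEγ, hdev⟩ := hdev
  obtain ⟨Ψ, hΨ, hle, hint⟩ := hB
  let e := MeasurableEquiv.sumPiEquivProdPi fun _ : κ ⊕ τ => X
  have hI : Measurable fun q : (ι → X) × (κ ⊕ τ → X) => E.indicator (1 : (ι → X) → ℝ≥0∞) q.1 :=
    (measurable_one.indicator hE).comp measurable_fst
  have hΨe : Measurable fun q : (ι → X) × (κ ⊕ τ → X) => Ψ (e q.2) :=
    hΨ.comp (e.measurable.comp measurable_snd)
  refine ⟨fun q => E.indicator 1 q.1 + (G * 2⁻¹ ^ s + Ψ (e q.2)),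
    hI.add (measurable_const.add hΨe), fun T U h hh hρ => ?_, ?_⟩
  · beta_reduce
    by_cases hT : T ∈ E
    · have := isMarkovKernel_gibbsStep (ι := ι) (B := B) hm hC ⟨h, hh⟩
      refine le_add_right ?_
      rw [Set.indicator_of_mem hT]
      exact prob_le_one
    · rw [Set.indicator_of_notMem hT, zero_add, add_comm]
      refine gibbsStep_le hm hC hG hh T U fun g hg hgs => ?_
      refine hle (U ∘ Sum.inl) (U ∘ Sum.inr) g hg ((genError_triangle c h g).trans ?_)
      gcongr
      exact hdev T hT g hg h hh hgs
  · have h1 := measurePreserving_sumPiEquivProdPi fun _ : κ ⊕ τ => μ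
    beta_reduce
    rw [lintegral_add_left hI, lintegral_add_left measurable_const, lintegral_const, measure_univ,
      mul_one, add_assoc]
    gcongr
    · rw [lintegral_prod _ hI.aemeasurable]
      simp only [lintegral_const, measure_univ, mul_one]
      rwa [lintegral_indicator_one hE]
    · rw [lintegral_prod _ hΨe.aemeasurable]
      simp only [lintegral_const, measure_univ, mul_one]
      rw [h1.lintegral_comp hΨ]
      exact hint

end Mechanism

/-! ### One-sided uniform deviations -/

theorem measurePreserving_comp_of_injective {X : Type*} [MeasurableSpace X] {ι ι' : Type*}
    [Fintype ι] [Fintype ι'] (μ : Measure X) [IsProbabilityMeasure μ] {f : ι → ι'}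
    (hf : Function.Injective f) :
    MeasurePreserving (fun T : ι' → X => T ∘ f) (Measure.pi fun _ => μ)
      (Measure.pi fun _ => μ) := by
  classical
  have hmeas : Measurable fun T : ι' → X => T ∘ f :=
    measurable_pi_lambda _ fun i => measurable_pi_apply (f i)
  refine ⟨hmeas, (Measure.pi_eq fun s hs => ?_).symm⟩
  rw [Measure.map_apply hmeas (MeasurableSet.univ_pi hs)]
  have hpre : (fun T : ι' → X => T ∘ f) ⁻¹' Set.univ.pi s =
      Set.univ.pi fun j => ⋂ i, ⋂ (_ : f i = j), s i := by
    ext T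
    simp only [Set.mem_preimage, Set.mem_univ_pi, Set.mem_iInter, Function.comp_apply]
    exact ⟨fun h j i hij => hij ▸ h i, fun h i => h _ i rfl⟩
  rw [hpre, Measure.pi_pi, ← Finset.prod_subset (Finset.subset_univ (Finset.univ.image f)),
    Finset.prod_image fun _ _ _ _ h => hf h]
  · refine Finset.prod_congr rfl fun i _ => ?_
    congr 1
    ext x
    simp [hf.eq_iff]
  · intro j _ hj
    have : (⋂ i, ⋂ (_ : f i = j), s i) = Set.univ := by
      refine Set.iInter_eq_univ.2 fun i => Set.iInter_eq_univ.2 fun h => ?_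
      exact absurd (Finset.mem_image.2 ⟨i, Finset.mem_univ _, h⟩) hj
    rw [this, measure_univ]

/-! ### Random swaps of a double sample -/

section Swap

variable {ι : Type*} [Fintype ι]

/-- The permutation of `ι ⊕ ι` that exchanges the two copies of the indices marked by `σ`. -/
def swapMarked (σ : ι → Bool) : ι ⊕ ι → ι ⊕ ι :=
  Sum.elim (fun i => if σ i then Sum.inr i else Sum.inl i)
    (fun i => if σ i then Sum.inl i else Sum.inr i)

theorem swapMarked_involutive (σ : ι → Bool) : Function.Involutive (swapMarked σ) := by
  rintro (i | i) <;> cases h : σ i <;> simp [swapMarked, h]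

/-- At most `s` ones in the first half and at least `4 s` ones in the second half. -/
def Unbalanced (s : ℕ) (u : ι ⊕ ι → Bool) : Prop :=
  (Finset.univ.filter fun i => u (Sum.inl i) = true).card ≤ s ∧
    4 * s ≤ (Finset.univ.filter fun i => u (Sum.inr i) = true).card

open Classical in
-- Exponential Markov inequality with weight 1/2 for a one in the first half and 3/2 for a one in
-- the second. Over a random swap each index contributes a mean of at most 1, whereas an unbalanced
-- outcome has product at least `(1/2)^s (3/2)^(4s) = (81/32)^s`.
theorem card_unbalanced_swap_le (s : ℕ) (u : ι ⊕ ι → Bool) :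
    ((Finset.univ.filter fun σ : ι → Bool => Unbalanced s (u ∘ swapMarked σ)).card : ℝ) ≤
      2 ^ Fintype.card ι * (32 / 81) ^ s := by
  let f : ι → Bool → ℝ := fun i b =>
    (if (u ∘ swapMarked fun _ => b) (Sum.inl i) = true then 1 / 2 else 1) *
      (if (u ∘ swapMarked fun _ => b) (Sum.inr i) = true then 3 / 2 else 1)
  have hf0 : ∀ i b, 0 ≤ f i b := fun i b => by
    simp only [f]; positivity
  have hind : ∀ σ : ι → Bool, (if Unbalanced s (u ∘ swapMarked σ) then (1 : ℝ) else 0) ≤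
      (32 / 81) ^ s * ∏ i, f i (σ i) := by
    intro σ
    split_ifs with h
    swap
    · exact mul_nonneg (by positivity) (Finset.prod_nonneg fun i _ => hf0 i _)
    have hprod : ∏ i, f i (σ i) =
        (1 / 2) ^ (Finset.univ.filter fun i => (u ∘ swapMarked σ) (Sum.inl i) = true).card *
        (3 / 2) ^ (Finset.univ.filter fun i => (u ∘ swapMarked σ) (Sum.inr i) = true).card := by
      rw [Finset.prod_mul_distrib]
      congr 1
      · rw [← Finset.prod_const, Finset.prod_filter]
        rfl
      · rw [← Finset.prod_const, Finset.prod_filter]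
        rfl
    rw [hprod]
    calc (1 : ℝ) = (32 / 81) ^ s * ((1 / 2) ^ s * (3 / 2) ^ (4 * s)) := by
          rw [pow_mul, ← mul_pow, ← mul_pow]; norm_num
      _ ≤ _ := by
          gcongr ?_ * (?_ * ?_)
          · exact pow_le_pow_of_le_one (by norm_num) (by norm_num) h.1
          · exact pow_le_pow_right₀ (by norm_num) h.2
  calc ((Finset.univ.filter fun σ : ι → Bool => Unbalanced s (u ∘ swapMarked σ)).card : ℝ)
      = ∑ σ : ι → Bool, if Unbalanced s (u ∘ swapMarked σ) then (1 : ℝ) else 0 := by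
        rw [Finset.sum_boole]
    _ ≤ ∑ σ : ι → Bool, (32 / 81) ^ s * ∏ i, f i (σ i) := Finset.sum_le_sum fun σ _ => hind σ
    _ = (32 / 81) ^ s * ∏ i, ∑ b, f i b := by
        rw [← Finset.mul_sum, Finset.prod_univ_sum, Fintype.piFinset_univ]
    _ ≤ (32 / 81) ^ s * ∏ i : ι, 2 := by
        refine mul_le_mul_of_nonneg_left (Finset.prod_le_prod
          (fun i _ => Finset.sum_nonneg fun b _ => hf0 i b) fun i _ => ?_) (by positivity)
        · simp only [f, swapMarked, Fintype.sum_bool, Function.comp_apply, Sum.elim_inl,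
            Sum.elim_inr, if_true, Bool.false_eq_true, if_false]
          rcases u (Sum.inl i) <;> rcases u (Sum.inr i) <;> norm_num
    _ = _ := by
        rw [Finset.prod_const, Finset.card_univ, mul_comm]

end Swap

/-! ### Symmetrization with a ghost sample -/

section Deviation

variable {X : Type u} [MeasurableSpace X] {ι : Type*} [Fintype ι]

/-- Chernoff's lower tail: the mean of `2^(-N)` is at most `exp (-4 s)`, and Markov's inequality at
the level `2^(-4 s)` leaves `(16 e^(-4))^s ≤ 1/2`. -/
theorem half_le_measure_card_ge (μ : Measure X) [IsProbabilityMeasure μ] {D : X → Bool}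
    (hD : Measurable D) {s : ℕ} (hs : 1 ≤ s)
    (hρ : 8 * (s : ℝ) ≤ μ.real {x | D x = true} * Fintype.card ι) :
    1 / 2 ≤ (Measure.pi fun _ : ι => μ)
      {T | 4 * s ≤ (Finset.univ.filter fun i => D (T i) = true).card} := by
  set p := μ.real {x | D x = true} with hp
  set ν := Measure.pi fun _ : ι => μ
  set N : (ι → X) → ℕ := fun T => (Finset.univ.filter fun i => D (T i) = true).card with hN
  have hNm : Measurable N := by
    have : Measurable fun y : ι → Bool => (Finset.univ.filter fun i => y i = true).card :=
      measurable_of_countable _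
    exact this.comp (measurable_pi_lambda _ fun i => hD.comp (measurable_pi_apply i))
  have hDs : MeasurableSet {x | D x = true} := hD (measurableSet_singleton true)
  have hprod : ∀ T, (1 / 2 : ℝ) ^ N T = ∏ i, if D (T i) = true then (1 / 2 : ℝ) else 1 := by
    intro T
    rw [hN, ← Finset.prod_const, Finset.prod_filter]
  have hone : ∫ x, (if D x = true then (1 / 2 : ℝ) else 1) ∂μ = 1 - p / 2 := by
    have : (fun x => if D x = true then (1 / 2 : ℝ) else 1) =
        fun x => 1 - {x | D x = true}.indicator (fun _ => (1 / 2 : ℝ)) x := by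
      funext x
      by_cases h : D x = true <;> simp [h]
      norm_num
    rw [this, integral_sub (integrable_const _)
      ((integrable_const _).indicator hDs), integral_indicator_const _ hDs]
    simp [hp]
    ring
  have hint : ∫ T, (1 / 2 : ℝ) ^ N T ∂ν = (1 - p / 2) ^ Fintype.card ι := by
    simp only [hprod]
    rw [integral_fintype_prod_eq_pow (fun x => if D x = true then (1 / 2 : ℝ) else 1), hone]
  have hp1 : p ≤ 1 := measureReal_le_one
  have hle : (1 - p / 2) ^ Fintype.card ι ≤ Real.exp (-(4 * s)) := by
    calc (1 - p / 2) ^ Fintype.card ι ≤ Real.exp (-(p / 2)) ^ Fintype.card ι := by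
          gcongr
          · linarith
          · linarith [Real.add_one_le_exp (-(p / 2))]
      _ = Real.exp (-(p * Fintype.card ι / 2)) := by
          rw [← Real.exp_nat_mul]; congr 1; ring
      _ ≤ _ := Real.exp_le_exp.2 (by linarith)
  have hbdd : Integrable (fun T => (1 / 2 : ℝ) ^ N T) ν := by
    refine Integrable.of_bound (C := 1) ?_ (Filter.Eventually.of_forall fun T => ?_)
    · exact ((measurable_of_countable fun k : ℕ => (1 / 2 : ℝ) ^ k).comp hNm).aestronglyMeasurable
    · rw [Real.norm_of_nonneg (by positivity)]
      exact pow_le_one₀ (by norm_num) (by norm_num)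
  have hmarkov := mul_meas_ge_le_integral_of_nonneg
    (Filter.Eventually.of_forall fun T => by positivity) hbdd ((1 / 2 : ℝ) ^ (4 * s))
  have hreal : ν.real {T | N T < 4 * s} ≤ 1 / 2 := by
    have hsub : ν.real {T | N T < 4 * s} ≤ ν.real {T | (1 / 2 : ℝ) ^ (4 * s) ≤ (1 / 2) ^ N T} :=
      measureReal_mono fun T (hT : N T < 4 * s) =>
        pow_le_pow_of_le_one (a := (1 / 2 : ℝ)) (by norm_num) (by norm_num) hT.le
    have h16 : (0 : ℝ) < (1 / 2) ^ (4 * s) := by positivity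
    have hexp : Real.exp (-(4 * s)) ≤ (1 / 2) ^ (4 * s) * (1 / 2) := by
      have he : Real.exp (-4) ≤ 1 / 32 := by
        rw [Real.exp_neg, one_div]
        refine inv_anti₀ (by norm_num) ?_
        calc (32 : ℝ) ≤ 2.7 ^ 4 := by norm_num
          _ ≤ Real.exp 1 ^ 4 := by
              gcongr
              exact (by norm_num : (2.7 : ℝ) ≤ 2.7182818283).trans Real.exp_one_gt_d9.le
          _ = Real.exp 4 := by rw [← Real.exp_nat_mul]; norm_num
      calc Real.exp (-(4 * s)) = Real.exp (-4) ^ s := by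
            rw [← Real.exp_nat_mul]; congr 1; ring
        _ ≤ (1 / 32) ^ s := by gcongr
        _ = (1 / 16) ^ s * (1 / 2) ^ s := by rw [← mul_pow]; norm_num
        _ ≤ (1 / 16) ^ s * (1 / 2) ^ 1 := by
            gcongr ?_ * ?_
            exact pow_le_pow_of_le_one (by norm_num) (by norm_num) hs
        _ = _ := by rw [pow_mul]; norm_num
    have : (1 / 2 : ℝ) ^ (4 * s) * ν.real {T | N T < 4 * s} ≤ (1 / 2) ^ (4 * s) * (1 / 2) := by
      calc _ ≤ (1 / 2 : ℝ) ^ (4 * s) * ν.real {T | (1 / 2 : ℝ) ^ (4 * s) ≤ (1 / 2) ^ N T} := by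
            gcongr
        _ ≤ _ := hmarkov
        _ ≤ _ := hint.le.trans (hle.trans hexp)
    exact le_of_mul_le_mul_left this h16
  have hcompl : {T | 4 * s ≤ N T} = {T | N T < 4 * s}ᶜ := by ext; simp
  have hlt : MeasurableSet {T | N T < 4 * s} := hNm measurableSet_Iio
  rw [hcompl, prob_compl_eq_one_sub hlt]
  have h2 : ν {T | N T < 4 * s} ≤ 1 / 2 := by
    rw [← ofReal_measureReal]
    refine (ENNReal.ofReal_le_ofReal hreal).trans_eq ?_
    rw [ENNReal.ofReal_div_of_pos (by norm_num)]; simp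
  calc (1 / 2 : ℝ≥0∞) = 1 - 1 / 2 := by simp
    _ ≤ _ := by gcongr

/-- For a family of classes with few dichotomies, samples on which some hypothesis has few ones
although it has probability more than `ρ` are rare. -/
theorem exists_deviation_set {P : Type*} [MeasurableSpace P] (𝒟 : P → Set (X → Bool))
    (hmeas : ∀ u : ι ⊕ ι → Bool,
      MeasurableSet {q : P × (ι ⊕ ι → X) | Realizes (𝒟 q.1) q.2 u})
    {G : ℝ≥0∞} (hG : ∀ p, ∀ T : ι ⊕ ι → X,
      ((Set.toFinite {u | Realizes (𝒟 p) T u}).toFinset.card : ℝ≥0∞) ≤ G)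
    (μ : Measure X) [IsProbabilityMeasure μ] {s : ℕ} (hs : 1 ≤ s) {ρ : ℝ}
    (hρ : 8 * (s : ℝ) ≤ ρ * Fintype.card ι) :
    ∃ E : Set (P × (ι → X)), MeasurableSet E ∧
      (∀ p T, (p, T) ∉ E → ∀ D ∈ 𝒟 p, Measurable D →
        (Finset.univ.filter fun i => D (T i) = true).card ≤ s → μ.real {x | D x = true} ≤ ρ) ∧
      ∀ p, (Measure.pi fun _ : ι => μ) {T | (p, T) ∈ E} ≤
        2 * (G * ENNReal.ofReal ((32 / 81) ^ s)) := by
  classical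
  set ν := Measure.pi fun _ : ι => μ with hν
  let B : Set (P × (ι ⊕ ι → X)) :=
    ⋃ u ∈ {u : ι ⊕ ι → Bool | Unbalanced s u}, {q | Realizes (𝒟 q.1) q.2 u}
  have hB : MeasurableSet B :=
    MeasurableSet.biUnion (Set.to_countable _) fun u _ => hmeas u
  let e := MeasurableEquiv.sumPiEquivProdPi fun _ : ι ⊕ ι => X
  let B' : Set ((P × (ι → X)) × (ι → X)) := (fun q => (q.1.1, e.symm (q.1.2, q.2))) ⁻¹' B
  have hB' : MeasurableSet B' := by
    refine Measurable.prodMk (measurable_fst.comp measurable_fst) (e.symm.measurable.comp ?_) hB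
    exact (measurable_snd.comp measurable_fst).prodMk measurable_snd
  -- Defining `E` by the probability of a bad ghost sample, instead of by the existence of a bad
  -- hypothesis, makes it measurable jointly in the parameter and the sample.
  let E : Set (P × (ι → X)) := {q | 1 / 2 ≤ ν (Prod.mk q ⁻¹' B')}
  have hE : MeasurableSet E := measurableSet_le measurable_const (measurable_measure_prodMk_left hB')
  have hpair : ∀ p, (Measure.pi fun _ : ι ⊕ ι => μ) (Prod.mk p ⁻¹' B) ≤
      G * ENNReal.ofReal ((32 / 81) ^ s) := by
    intro p
    set ν₂ := Measure.pi fun _ : ι ⊕ ι => μ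
    have hBp : MeasurableSet (Prod.mk p ⁻¹' B) := measurable_prodMk_left hB
    have hswap : ∀ σ : ι → Bool, ν₂ (Prod.mk p ⁻¹' B) =
        ∫⁻ T, (Prod.mk p ⁻¹' B).indicator 1 (T ∘ swapMarked σ) ∂ν₂ := by
      intro σ
      have hpres := measurePreserving_comp_of_injective μ (swapMarked_involutive σ).injective
      rw [hpres.lintegral_comp (measurable_one.indicator hBp), lintegral_indicator_one hBp]
    -- With the double sample fixed, only its realized dichotomies matter, and each is unbalanced
    -- for few swaps.
    have hpoint : ∀ T : ι ⊕ ι → X, ∑ σ : ι → Bool,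
        (Prod.mk p ⁻¹' B).indicator (1 : (ι ⊕ ι → X) → ℝ≥0∞) (T ∘ swapMarked σ) ≤
        2 ^ Fintype.card ι * (G * ENNReal.ofReal ((32 / 81) ^ s)) := by
      intro T
      set 𝒰 := (Set.toFinite {u | Realizes (𝒟 p) T u}).toFinset with h𝒰
      calc _ ≤ ∑ σ : ι → Bool, ∑ u ∈ 𝒰,
            if Unbalanced s (u ∘ swapMarked σ) then (1 : ℝ≥0∞) else 0 := by
            refine Finset.sum_le_sum fun σ _ => ?_
            by_cases h : T ∘ swapMarked σ ∈ Prod.mk p ⁻¹' B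
            swap
            · rw [Set.indicator_of_notMem h]; exact zero_le
            rw [Set.indicator_of_mem h]
            simp only [B, Set.mem_preimage, Set.mem_iUnion, Set.mem_ofPred_eq, exists_prop] at h
            obtain ⟨v, hv, hreal⟩ := h
            have hvu : (v ∘ swapMarked σ) ∘ swapMarked σ = v := by
              rw [Function.comp_assoc, (swapMarked_involutive σ).comp_self, Function.comp_id]
            have hmem : v ∘ swapMarked σ ∈ 𝒰 := by
              have := hreal.comp (swapMarked σ)
              rw [Function.comp_assoc, (swapMarked_involutive σ).comp_self,
                Function.comp_id] at this
              simpa [h𝒰] using this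
            refine le_trans ?_ (Finset.single_le_sum (fun _ _ => zero_le) hmem)
            rw [hvu, if_pos hv]
            exact le_rfl
        _ = ∑ u ∈ 𝒰, ((Finset.univ.filter fun σ : ι → Bool =>
              Unbalanced s (u ∘ swapMarked σ)).card : ℝ≥0∞) := by
            rw [Finset.sum_comm]
            refine Finset.sum_congr rfl fun u _ => ?_
            rw [Finset.sum_boole]
        _ ≤ ∑ u ∈ 𝒰, 2 ^ Fintype.card ι * ENNReal.ofReal ((32 / 81) ^ s) := by
            refine Finset.sum_le_sum fun u _ => ?_
            have := ENNReal.ofReal_le_ofReal (card_unbalanced_swap_le s u)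
            rwa [ENNReal.ofReal_natCast, ENNReal.ofReal_mul (by positivity),
              ENNReal.ofReal_pow (by norm_num), ENNReal.ofReal_ofNat] at this
        _ = 2 ^ Fintype.card ι * (𝒰.card * ENNReal.ofReal ((32 / 81) ^ s)) := by
            rw [Finset.sum_const, nsmul_eq_mul]; ring
        _ ≤ _ := by
            gcongr
            exact hG p T
    have hsum : 2 ^ Fintype.card ι * ν₂ (Prod.mk p ⁻¹' B) ≤
        2 ^ Fintype.card ι * (G * ENNReal.ofReal ((32 / 81) ^ s)) := by
      calc 2 ^ Fintype.card ι * ν₂ (Prod.mk p ⁻¹' B)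
          = ∑ σ : ι → Bool, ν₂ (Prod.mk p ⁻¹' B) := by
            rw [Finset.sum_const, Finset.card_univ, Fintype.card_fun, Fintype.card_bool,
              nsmul_eq_mul]
            push_cast; rfl
        _ = ∑ σ : ι → Bool, ∫⁻ T, (Prod.mk p ⁻¹' B).indicator 1 (T ∘ swapMarked σ) ∂ν₂ :=
            Finset.sum_congr rfl fun σ _ => hswap σ
        _ = ∫⁻ T, ∑ σ : ι → Bool, (Prod.mk p ⁻¹' B).indicator 1 (T ∘ swapMarked σ) ∂ν₂ := by
            rw [lintegral_finsetSum]
            intro σ _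
            exact (measurable_one.indicator hBp).comp
              (measurable_pi_lambda _ fun i => measurable_pi_apply _)
        _ ≤ ∫⁻ _, 2 ^ Fintype.card ι * (G * ENNReal.ofReal ((32 / 81) ^ s)) ∂ν₂ :=
            lintegral_mono hpoint
        _ = _ := by rw [lintegral_const, measure_univ, mul_one]
    exact (ENNReal.mul_le_mul_iff_right (by positivity) (by finiteness)).1 hsum
  refine ⟨E, hE, fun p T hT D hD hDm hDs => ?_, fun p => ?_⟩
  · by_contra! hlt
    refine hT ?_
    -- A hypothesis of large probability with few ones on `T` makes at least half of the ghost
    -- samples bad, which puts `(p, T)` into `E`.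
    have hhalf := half_le_measure_card_ge (ι := ι) μ hDm hs
      (hρ.trans (mul_le_mul_of_nonneg_right hlt.le (Nat.cast_nonneg _)))
    refine hhalf.trans (measure_mono fun T' hT' => ?_)
    simp only [B', B, Set.mem_preimage, Set.mem_iUnion, Set.mem_ofPred_eq, exists_prop]
    exact ⟨fun j => D (Sum.elim T T' j), ⟨hDs, hT'⟩, D, hD, by rintro (i | i) <;> rfl⟩
  · let Q : Set ((ι → X) × (ι → X)) := e.symm ⁻¹' (Prod.mk p ⁻¹' B)
    have hQ : MeasurableSet Q := e.symm.measurable (measurable_prodMk_left hB)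
    have hprod : (ν.prod ν) Q = (Measure.pi fun _ : ι ⊕ ι => μ) (Prod.mk p ⁻¹' B) :=
      (measurePreserving_sumPiEquivProdPi fun _ : ι ⊕ ι => μ).symm.measure_preimage
        (measurable_prodMk_left hB).nullMeasurableSet
    have hmarkov := mul_meas_ge_le_lintegral (μ := ν)
      (measurable_measure_prodMk_left (ν := ν) hQ) (1 / 2)
    rw [← Measure.prod_apply hQ, hprod] at hmarkov
    calc ν {T | (p, T) ∈ E} = 2 * 2⁻¹ * ν {T | 1 / 2 ≤ ν (Prod.mk T ⁻¹' Q)} := by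
          rw [ENNReal.mul_inv_cancel (by simp) (by simp), one_mul]
          rfl
      _ = 2 * (1 / 2 * ν {T | 1 / 2 ≤ ν (Prod.mk T ⁻¹' Q)}) := by
          rw [mul_assoc, one_div]
      _ ≤ _ := mul_le_mul_right (hmarkov.trans (hpair p)) 2

end Deviation

/-! ### The Sauer–Shelah bound for realized dichotomies -/

section Sauer

variable {X : Type u} {ι : Type*} [Fintype ι]

theorem card_le_of_shatteredBy {C : Set (X → Bool)} {d : ℕ} (hd : vcDimension C ≤ d)
    {B : Finset X} (hB : ShatteredBy C B) : B.card ≤ d := by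
  have : (B.card : ℕ∞) ≤ vcDimension C :=
    le_iSup₂ (f := fun (B : Finset X) (_ : ShatteredBy C B) => (B.card : ℕ∞)) B hB
  exact_mod_cast this.trans hd

/-- Sauer–Shelah for sets of indices. The sample may repeat points, but no realized set separates
indices of equal points, so `T` is injective on a shattered index set and its image is shattered by
`C`. -/
theorem card_realizes_le_sum_choose {C : Set (X → Bool)} {d : ℕ} (hd : vcDimension C ≤ d)
    (T : ι → X) :
    (Set.toFinite {g | Realizes C T g}).toFinset.card ≤
      ∑ k ∈ Finset.Iic d, (Fintype.card ι).choose k := by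
  classical
  let φ : (ι → Bool) → Finset ι := fun g => Finset.univ.filter fun i => g i = true
  have hφ : Function.Injective φ := by
    intro g g' h
    funext i
    have := congrArg (fun A => i ∈ A) h
    simp only [φ, Finset.mem_filter, Finset.mem_univ, true_and, eq_iff_iff] at this
    exact Bool.eq_iff_iff.2 this
  set 𝒜 := (Set.toFinite {g | Realizes C T g}).toFinset.image φ with h𝒜
  have hcard : (Set.toFinite {g | Realizes C T g}).toFinset.card = 𝒜.card :=
    (Finset.card_image_of_injective _ hφ).symm
  have hmem : ∀ A, A ∈ 𝒜 ↔ ∃ c ∈ C, ∀ i, i ∈ A ↔ c (T i) = true := by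
    intro A
    simp only [h𝒜, Finset.mem_image, Set.Finite.mem_toFinset, Set.mem_ofPred_eq]
    constructor
    · rintro ⟨g, ⟨c, hc, hg⟩, rfl⟩
      exact ⟨c, hc, fun i => by simp [φ, hg]⟩
    · rintro ⟨c, hc, hA⟩
      exact ⟨c ∘ T, realizes_comp hc T, by ext i; simp [φ, hA]⟩
  have hvc : 𝒜.vcDim ≤ d := by
    refine Finset.sup_le fun s hs => ?_
    rw [Finset.mem_shatterer] at hs
    have hinj : Set.InjOn T s := by
      intro i hi j hj hij
      by_contra hne
      obtain ⟨A, hA, hsA⟩ := hs (Finset.singleton_subset_iff.2 hi)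
      obtain ⟨c, hc, hcA⟩ := (hmem A).1 hA
      have h1 : i ∈ A := (Finset.mem_inter.1 (hsA ▸ Finset.mem_singleton_self i)).2
      have h2 : j ∉ A := fun h => by
        have : j ∈ s ∩ A := Finset.mem_inter.2 ⟨hj, h⟩
        rw [hsA, Finset.mem_singleton] at this
        exact hne this.symm
      rw [hcA, hij, ← hcA] at h1
      exact h2 h1
    rw [← Finset.card_image_of_injOn hinj]
    refine card_le_of_shatteredBy hd fun f => ?_
    obtain ⟨A, hA, hsA⟩ := hs (Finset.filter_subset (fun i => f (T i) = true) s)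
    obtain ⟨c, hc, hcA⟩ := (hmem A).1 hA
    refine ⟨c, hc, fun x hx => ?_⟩
    obtain ⟨i, hi, rfl⟩ := Finset.mem_image.1 hx
    rw [Bool.eq_iff_iff, ← hcA]
    have := congrArg (fun B => i ∈ B) hsA
    simpa [hi] using this
  calc _ = 𝒜.card := hcard
    _ ≤ _ := 𝒜.card_le_card_shatterer
    _ ≤ _ := Finset.card_shatterer_le_sum_vcDim
    _ ≤ _ := Finset.sum_le_sum_of_subset (Finset.Iic_subset_Iic.2 hvc)

/-- With `q = d / M ≤ 1`, multiplication by `q ^ d` bounds the sum by the binomial expansion of `(1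
+ q) ^ m ≤ exp (M q) = exp d`. -/
theorem sum_choose_le_pow {d m : ℕ} (hd : 1 ≤ d) {M : ℝ} (hdM : d ≤ M) (hmM : m ≤ M) :
    ((∑ k ∈ Finset.Iic d, m.choose k : ℕ) : ℝ) ≤ (Real.exp 1 * M / d) ^ d := by
  have hd0 : (0 : ℝ) < d := by exact_mod_cast hd
  have hM0 : 0 < M := hd0.trans_le hdM
  set q := (d : ℝ) / M with hq
  have hq0 : 0 < q := by positivity
  have hq1 : q ≤ 1 := (div_le_one hM0).2 hdM
  have h1 : q ^ d * ((∑ k ∈ Finset.Iic d, m.choose k : ℕ) : ℝ) ≤ (1 + q) ^ m := by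
    push_cast
    rw [Finset.mul_sum]
    calc ∑ k ∈ Finset.Iic d, q ^ d * (m.choose k : ℝ)
        ≤ ∑ k ∈ Finset.Iic d, q ^ k * (m.choose k : ℝ) := by
          refine Finset.sum_le_sum fun k hk => mul_le_mul_of_nonneg_right ?_ (Nat.cast_nonneg _)
          exact pow_le_pow_of_le_one hq0.le hq1 (Finset.mem_Iic.1 hk)
      _ ≤ ∑ k ∈ Finset.range (m + 1) ∪ Finset.Iic d, q ^ k * (m.choose k : ℝ) :=
          Finset.sum_le_sum_of_subset_of_nonneg Finset.subset_union_right
            fun _ _ _ => by positivity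
      _ = ∑ k ∈ Finset.range (m + 1), q ^ k * (m.choose k : ℝ) := by
          refine (Finset.sum_subset Finset.subset_union_left fun k _ hk => ?_).symm
          rw [Nat.choose_eq_zero_of_lt (by simpa using hk)]
          simp
      _ = (1 + q) ^ m := by
          rw [add_comm 1 q, add_pow]
          simp
  have h2 : (1 + q) ^ m ≤ Real.exp 1 ^ d := by
    calc (1 + q) ^ m ≤ Real.exp q ^ m := by
          gcongr
          linarith [Real.add_one_le_exp q]
      _ = Real.exp (m * q) := by rw [← Real.exp_nat_mul]
      _ ≤ Real.exp (M * q) := by gcongr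
      _ = Real.exp 1 ^ d := by
          rw [← Real.exp_nat_mul, hq, mul_one, mul_div_cancel₀ _ hM0.ne']
  have h3 : (Real.exp 1 * M / d) ^ d = (q ^ d)⁻¹ * Real.exp 1 ^ d := by
    rw [← inv_pow, ← mul_pow, hq, inv_div]; ring_nf
  rw [h3, ← div_eq_inv_mul, le_div_iff₀ (by positivity), mul_comm]
  exact h1.trans h2

/-- The growth function of `C` is at most `(e M / d) ^ d` at sample sizes up to `M`. -/
theorem card_realizes_le_ofReal {C : Set (X → Bool)} {d : ℕ} (hd : vcDimension C ≤ d)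
    (hd1 : 1 ≤ d) {M : ℝ} (hdM : d ≤ M) (hιM : Fintype.card ι ≤ M) (T : ι → X) :
    ((Set.toFinite {g | Realizes C T g}).toFinset.card : ℝ≥0∞) ≤
      ENNReal.ofReal ((Real.exp 1 * M / d) ^ d) := by
  rw [← ENNReal.ofReal_natCast]
  refine ENNReal.ofReal_le_ofReal (le_trans ?_ (sum_choose_le_pow hd1 hdM hιM))
  exact_mod_cast card_realizes_le_sum_choose hd T

end Sauer

/-! ### Deviations of disagreement sets -/

section Disagreement

variable {X : Type u} [MeasurableSpace X] {ι : Type*} [Fintype ι] {C : Set (X → Bool)}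

theorem exists_pair_deviation_set (hm : ∀ c ∈ C, Measurable c)
    (hC : TopologicalSpace.SeparableSpace C) {G : ℝ≥0∞}
    (hG : ∀ T : ι ⊕ ι → X, ((Set.toFinite {u | Realizes C T u}).toFinset.card : ℝ≥0∞) ≤ G)
    (μ : Measure X) [IsProbabilityMeasure μ] {s : ℕ} (hs : 1 ≤ s) {ρ : ℝ}
    (hρ : 8 * (s : ℝ) ≤ ρ * Fintype.card ι) :
    ∃ E : Set (ι → X), MeasurableSet E ∧
      (Measure.pi fun _ : ι => μ) E ≤ 2 * (G * G * ENNReal.ofReal ((32 / 81) ^ s)) ∧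
      ∀ T ∉ E, ∀ g ∈ C, ∀ h ∈ C,
        (Finset.univ.filter fun i => g (T i) ≠ h (T i)).card ≤ s → genError μ h g ≤ ρ := by
  classical
  let 𝒟 : Unit → Set (X → Bool) := fun _ => {D | ∃ g ∈ C, ∃ h ∈ C, D = fun x => xor (g x) (h x)}
  have hreal : ∀ (p : Unit) (T : ι ⊕ ι → X) (u : ι ⊕ ι → Bool), Realizes (𝒟 p) T u ↔
      ∃ a b : ι ⊕ ι → Bool, (∀ i, u i = xor (a i) (b i)) ∧ Realizes C T a ∧ Realizes C T b := by
    intro p T u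
    constructor
    · rintro ⟨D, ⟨g, hg, h, hh, rfl⟩, hu⟩
      exact ⟨g ∘ T, h ∘ T, fun i => (hu i).symm, realizes_comp hg T, realizes_comp hh T⟩
    · rintro ⟨a, b, hu, ⟨g, hg, ha⟩, ⟨h, hh, hb⟩⟩
      exact ⟨_, ⟨g, hg, h, hh, rfl⟩, fun i => by rw [hu i, ha, hb]⟩
  have hmeas : ∀ u : ι ⊕ ι → Bool,
      MeasurableSet {q : Unit × (ι ⊕ ι → X) | Realizes (𝒟 q.1) q.2 u} := by
    intro u
    simp only [hreal, Set.ofPred_exists]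
    refine MeasurableSet.iUnion fun a => MeasurableSet.iUnion fun b => ?_
    exact (MeasurableSet.const _).inter
      ((measurable_snd (measurableSet_realizes hm hC a)).inter
        (measurable_snd (measurableSet_realizes hm hC b)))
  have hcard : ∀ p, ∀ T : ι ⊕ ι → X,
      ((Set.toFinite {u | Realizes (𝒟 p) T u}).toFinset.card : ℝ≥0∞) ≤ G * G := by
    intro p T
    set 𝒰 := (Set.toFinite {u | Realizes C T u}).toFinset
    have hsub : (Set.toFinite {u | Realizes (𝒟 p) T u}).toFinset ⊆
        (𝒰 ×ˢ 𝒰).image fun q i => xor (q.1 i) (q.2 i) := by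
      intro u hu
      simp only [Set.Finite.mem_toFinset, Set.mem_ofPred_eq] at hu
      obtain ⟨a, b, hab, ha, hb⟩ := (hreal p T u).1 hu
      refine Finset.mem_image.2 ⟨(a, b), ?_, funext fun i => (hab i).symm⟩
      simpa [𝒰] using ⟨ha, hb⟩
    calc _ ≤ ((𝒰 ×ˢ 𝒰).card : ℝ≥0∞) := by
          exact_mod_cast (Finset.card_le_card hsub).trans Finset.card_image_le
      _ = 𝒰.card * 𝒰.card := by rw [Finset.card_product]; push_cast; rfl
      _ ≤ G * G := mul_le_mul' (hG T) (hG T)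
  obtain ⟨E, hE, hdev, hν⟩ := exists_deviation_set 𝒟 hmeas hcard μ hs hρ
  refine ⟨{T | ((), T) ∈ E}, measurable_prodMk_left hE, hν (), fun T hT g hg h hh hgs => ?_⟩
  have := hdev () T hT _ ⟨g, hg, h, hh, rfl⟩
    ((measurable_of_countable fun q : Bool × Bool => xor q.1 q.2).comp
      ((hm g hg).prodMk (hm h hh))) (by simpa using hgs)
  simpa [genError] using this

/-- For a fixed output `r` the disagreement sets with `C` have dichotomies that are translates of
those of `C`, so the richness of the hypothesis space plays no role. Keeping `r` as a parameter
gives the joint measurability needed to integrate over the output later. -/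
theorem exists_hypothesis_deviation_set (hm : ∀ c ∈ C, Measurable c)
    (hC : TopologicalSpace.SeparableSpace C) (H : HypothesisSpace.{u, v} X) {G : ℝ≥0∞}
    (hG : ∀ T : ι ⊕ ι → X, ((Set.toFinite {u | Realizes C T u}).toFinset.card : ℝ≥0∞) ≤ G)
    (μ : Measure X) [IsProbabilityMeasure μ] {s : ℕ} (hs : 1 ≤ s) {ρ : ℝ}
    (hρ : 8 * (s : ℝ) ≤ ρ * Fintype.card ι) :
    ∃ E : Set (H.carrier × (ι → X)), MeasurableSet E ∧
      (∀ r T, (r, T) ∉ E → ∀ h ∈ C,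
        (Finset.univ.filter fun i => H.eval r (T i) ≠ h (T i)).card ≤ s →
          genError μ h (H.eval r) ≤ ρ) ∧
      ∀ r, (Measure.pi fun _ : ι => μ) {T | (r, T) ∈ E} ≤
        2 * (G * ENNReal.ofReal ((32 / 81) ^ s)) := by
  classical
  let 𝒟 : H.carrier → Set (X → Bool) := fun r =>
    {D | ∃ h ∈ C, D = fun x => xor (H.eval r x) (h x)}
  have hreal : ∀ (r : H.carrier) (T : ι ⊕ ι → X) (u : ι ⊕ ι → Bool), Realizes (𝒟 r) T u ↔
      ∃ a : ι ⊕ ι → Bool, (∀ i, xor (H.eval r (T i)) (a i) = u i) ∧ Realizes C T a := by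
    intro r T u
    constructor
    · rintro ⟨D, ⟨h, hh, rfl⟩, hu⟩
      exact ⟨h ∘ T, fun i => hu i, realizes_comp hh T⟩
    · rintro ⟨b, hu, ⟨h, hh, hb⟩⟩
      exact ⟨_, ⟨h, hh, rfl⟩, fun i => by rw [← hu i, hb]⟩
  have hxor : Measurable fun q : Bool × Bool => xor q.1 q.2 := measurable_of_countable _
  have hmeas : ∀ u : ι ⊕ ι → Bool,
      MeasurableSet {q : H.carrier × (ι ⊕ ι → X) | Realizes (𝒟 q.1) q.2 u} := by
    intro u
    simp only [hreal, Set.ofPred_exists, Set.ofPred_and, Set.ofPred_forall]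
    refine MeasurableSet.iUnion fun a =>
      MeasurableSet.inter ?_ (measurable_snd (measurableSet_realizes hm hC a))
    refine MeasurableSet.iInter fun i => ?_
    have : Measurable fun q : H.carrier × (ι ⊕ ι → X) => xor (H.eval q.1 (q.2 i)) (a i) :=
      hxor.comp ((H.measurable_eval.comp
        (measurable_fst.prodMk ((measurable_pi_apply i).comp measurable_snd))).prodMk
          measurable_const)
    exact this (measurableSet_singleton (u i))
  have hcard : ∀ r, ∀ T : ι ⊕ ι → X,
      ((Set.toFinite {u | Realizes (𝒟 r) T u}).toFinset.card : ℝ≥0∞) ≤ G := by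
    intro r T
    have hsub : (Set.toFinite {u | Realizes (𝒟 r) T u}).toFinset ⊆
        (Set.toFinite {u | Realizes C T u}).toFinset.image
          fun a i => xor (H.eval r (T i)) (a i) := by
      intro u hu
      simp only [Set.Finite.mem_toFinset, Set.mem_ofPred_eq] at hu
      obtain ⟨a, hab, ha⟩ := (hreal r T u).1 hu
      exact Finset.mem_image.2 ⟨a, by simpa using ha, funext hab⟩
    refine le_trans ?_ (hG T)
    exact_mod_cast (Finset.card_le_card hsub).trans Finset.card_image_le
  obtain ⟨E, hE, hdev, hν⟩ := exists_deviation_set 𝒟 hmeas hcard μ hs hρ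
  refine ⟨E, hE, fun r T hT h hh hs => ?_, hν⟩
  have := hdev r T hT _ ⟨h, hh, rfl⟩
    (hxor.comp ((H.measurable_eval.comp (measurable_const.prodMk measurable_id)).prodMk (hm h hh)))
    (by simpa using hs)
  simpa [genError] using this

end Disagreement

/-! ### Running a learner on a resampled database -/

section Resample

variable {X : Type u} [MeasurableSpace X] {R : Type v} [MeasurableSpace R] {n w : ℕ}

/-- The fully labeled database of a learner that accepts partially labeled databases. -/
def fullyLabeled {ι : Type*} (S : ι → X × Bool) : ι → X × Option Bool :=
  fun i => ((S i).1, some (S i).2)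

theorem measurable_fullyLabeled {ι : Type*} :
    Measurable (fullyLabeled : (ι → X × Bool) → ι → X × Option Bool) := by
  refine measurable_pi_lambda _ fun i => ?_
  exact (measurable_pi_apply i).fst.prodMk
    ((measurable_of_countable (some : Bool → Option Bool)).comp (measurable_pi_apply i).snd)

theorem partiallyLabeled_self (c : X → Bool) (D : Fin n → X) :
    partiallyLabeled n c D = fullyLabeled fun i => (D i, c (D i)) := by
  funext i
  simp [partiallyLabeled, fullyLabeled]

theorem IsDifferentiallyPrivate.oneEntryStable {A : Kernel (Fin n → X × Option Bool) R} {ε δ : ℝ}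
    (hA : IsDifferentiallyPrivate A ε δ) (hε : 0 ≤ ε) {F : Set R} (hF : MeasurableSet F) :
    OneEntryStable (fun S : Fin n → X × Bool => A (fullyLabeled S) F)
      (ENNReal.ofReal (Real.exp ε)) (ENNReal.ofReal δ) := by
  intro a b t h
  -- Neighbors differ in exactly one entry, so equal databases are a separate case, which needs `1 ≤
  -- exp ε`.
  by_cases hab : fullyLabeled a = fullyLabeled b
  · simp only [hab]
    refine le_add_right (le_mul_of_one_le_left zero_le ?_)
    rw [← ENNReal.ofReal_one]
    exact ENNReal.ofReal_le_ofReal (Real.one_le_exp hε)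
  · refine hA _ _ ⟨t, fun ht => hab (funext fun i => ?_), fun i hi => ?_⟩ F hF
    · by_cases hit : i = t
      · exact hit ▸ ht
      · simp [fullyLabeled, h i hit]
    · by_contra hit
      exact hi (by simp [fullyLabeled, h i hit])

/-- Run `A` on `n` examples that are drawn independently and uniformly from a labeled pool. -/
noncomputable def resample (w : ℕ) (A : Kernel (Fin n → X × Option Bool) R) :
    Kernel ((Fin w → X × Bool) × (Empty → X)) R where
  toFun q := (Fintype.card (Fin n → Fin w) : ℝ≥0∞)⁻¹ •
    ∑ J : Fin n → Fin w, A (fullyLabeled fun t => q.1 (J t))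
  measurable' := by
    refine Measure.measurable_of_measurable_coe _ fun F hF => ?_
    simp only [Measure.smul_apply, Measure.coe_finsetSum, Finset.sum_apply, smul_eq_mul]
    refine (Finset.measurable_sum _ fun J _ => ?_).const_mul _
    refine (A.measurable_coe hF).comp (measurable_fullyLabeled.comp ?_)
    exact measurable_pi_lambda _ fun t => (measurable_pi_apply _).comp measurable_fst

theorem resample_apply (A : Kernel (Fin n → X × Option Bool) R)
    (q : (Fin w → X × Bool) × (Empty → X)) (F : Set R) :
    resample w A q F =
      uniformAverage fun J : Fin n → Fin w => A (fullyLabeled fun t => q.1 (J t)) F := by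
  simp [resample, uniformAverage]

theorem isMarkovKernel_resample (hw : 0 < w) (A : Kernel (Fin n → X × Option Bool) R)
    [IsMarkovKernel A] : IsMarkovKernel (resample w A) := by
  have : Nonempty (Fin w) := ⟨⟨0, hw⟩⟩
  refine ⟨fun q => ⟨?_⟩⟩
  rw [resample_apply]
  simp only [measure_univ]
  exact uniformAverage_const 1

theorem one_add_six_div_pow_le (hw : 2 ≤ w) (hn : 2 * n ≤ w) :
    (1 + ENNReal.ofReal (6 / w)) ^ n ≤ 21 := by
  have hw0 : (0 : ℝ) < w := by positivity
  rw [← ENNReal.ofReal_one, ← ENNReal.ofReal_add zero_le_one (by positivity),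
    ← ENNReal.ofReal_pow (by positivity), ← ENNReal.ofReal_ofNat 21]
  refine ENNReal.ofReal_le_ofReal ?_
  have h2 : (2 * n : ℝ) ≤ w := by exact_mod_cast hn
  calc (1 + 6 / (w : ℝ)) ^ n ≤ Real.exp (6 / w) ^ n := by
        gcongr
        linarith [Real.add_one_le_exp (6 / (w : ℝ))]
    _ = Real.exp (n * (6 / w)) := by rw [← Real.exp_nat_mul]
    _ ≤ Real.exp 3 := by
        refine Real.exp_le_exp.2 ?_
        rw [mul_div_assoc', div_le_iff₀ hw0]
        linarith
    _ = Real.exp 1 ^ 3 := by rw [← Real.exp_nat_mul]; norm_num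
    _ ≤ 2.7183 ^ 3 := by
        gcongr
        exact Real.exp_one_lt_d9.le.trans (by norm_num)
    _ ≤ 21 := by norm_num

/-- Each of the `n ≤ w / 2` draws hits the changed entry with probability `1 / w`, so the factor `e`
of `A` is diluted to `1 + 6 / w` per draw and to at most `exp 3 ≤ 21` in total. -/
theorem labeledStable_resample {A : Kernel (Fin n → X × Option Bool) R} {δ : ℝ}
    (hA : IsDifferentiallyPrivate A 1 δ) (hw : 2 ≤ w) (hn : 2 * n ≤ w) :
    LabeledStable (resample w A) 21 (21 * ENNReal.ofReal δ) := by
  intro S S' U i hS F hF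
  have hw0 : (2 : ℝ) ≤ w := by exact_mod_cast hw
  -- For `w ≥ 2` one has `6 (w - 1) / w ≥ 3 > e`.
  have hκ : ENNReal.ofReal (Real.exp 1) ≤
      ENNReal.ofReal (6 / w) * (Fintype.card (Fin w) - 1 : ℕ) := by
    rw [Fintype.card_fin, ← ENNReal.ofReal_natCast, ← ENNReal.ofReal_mul (by positivity)]
    refine ENNReal.ofReal_le_ofReal ?_
    rw [Nat.cast_sub (by omega), div_mul_eq_mul_div, le_div_iff₀ (by linarith)]
    have := Real.exp_one_lt_d9
    push_cast
    nlinarith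
  have hmain := uniformAverage_pi_le_pow (hA.oneEntryStable zero_le_one hF)
    (by simpa using hw) hκ S S' i hS
  rw [Fintype.card_fin, Fintype.card_fin] at hmain
  simp only [resample_apply]
  refine hmain.trans (add_le_add ?_ ?_)
  · gcongr
    exact one_add_six_div_pow_le hw hn
  · calc (n : ℝ≥0∞) * (1 + ENNReal.ofReal (6 / w)) ^ n * (ENNReal.ofReal δ * (w : ℝ≥0∞)⁻¹)
        ≤ w * 21 * (ENNReal.ofReal δ * (w : ℝ≥0∞)⁻¹) := by
          gcongr
          · omega
          · exact one_add_six_div_pow_le hw hn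
      _ = (w * (w : ℝ≥0∞)⁻¹) * (21 * ENNReal.ofReal δ) := by ring
      _ = 21 * ENNReal.ofReal δ := by
          rw [ENNReal.mul_inv_cancel (by simp; omega) (by simp), one_mul]

theorem unlabeledStable_empty {ι : Type*} [Fintype ι]
    (B : Kernel ((ι → X × Bool) × (Empty → X)) R) (Λ δ : ℝ≥0∞) : UnlabeledStable B Λ δ :=
  fun _ _ _ k => k.elim

end Resample

/-! ### Accuracy of the resampled learner -/

section ResampleAccuracy

variable {X : Type u} [MeasurableSpace X] {H : HypothesisSpace.{u, v} X} {n w : ℕ}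

theorem measurable_genError (μ : Measure X) [IsProbabilityMeasure μ] {c : X → Bool}
    (hc : Measurable c) : Measurable fun r : H.carrier => genError μ c (H.eval r) := by
  have hs : MeasurableSet {q : H.carrier × X | H.eval q.1 q.2 ≠ c q.2} :=
    (measurableSet_eq_fun H.measurable_eval (hc.comp measurable_snd)).compl
  exact (measurable_measure_prodMk_left (ν := μ) hs).ennreal_toReal

/-- The uniform distribution on the entries of a nonempty pool. -/
noncomputable def poolMeasure (T : Fin w → X) : Measure X :=
  ((w : ℝ≥0∞)⁻¹ • Measure.count).map T

theorem isProbabilityMeasure_count (hw : 0 < w) :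
    IsProbabilityMeasure ((w : ℝ≥0∞)⁻¹ • (Measure.count : Measure (Fin w))) := by
  refine ⟨?_⟩
  rw [Measure.smul_apply, Measure.count_univ, smul_eq_mul]
  simp only [ENat.card_eq_coe_fintype_card, Fintype.card_fin, ENat.toENNReal_coe]
  exact ENNReal.inv_mul_cancel (by simp; omega) (by simp)

theorem isProbabilityMeasure_poolMeasure (hw : 0 < w) (T : Fin w → X) :
    IsProbabilityMeasure (poolMeasure T) := by
  have := isProbabilityMeasure_count hw
  exact Measure.isProbabilityMeasure_map (measurable_of_countable T).aemeasurable

theorem genError_poolMeasure (T : Fin w → X) {c h : X → Bool} (hc : Measurable c)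
    (hh : Measurable h) : genError (poolMeasure T) c h =
      (Finset.univ.filter fun i => h (T i) ≠ c (T i)).card / w := by
  have hs : MeasurableSet {x | h x ≠ c x} := (measurableSet_eq_fun hh hc).compl
  rw [genError, measureReal_def, poolMeasure, Measure.map_apply (measurable_of_countable T) hs,
    Measure.smul_apply, Measure.count_apply (Set.toFinite _).measurableSet, smul_eq_mul,
    ENNReal.toReal_mul, ENNReal.toReal_inv, ENNReal.toReal_natCast, div_eq_inv_mul]
  have hpre : T ⁻¹' {x | h x ≠ c x} =
      ((Finset.univ.filter fun i => h (T i) ≠ c (T i) : Finset (Fin w)) : Set (Fin w)) := by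
    ext i; simp
  rw [hpre, Set.encard_coe_eq_coe_finsetCard]
  simp

theorem lintegral_pi_poolMeasure (hw : 0 < w) (T : Fin w → X) {f : (Fin n → X) → ℝ≥0∞}
    (hf : Measurable f) :
    ∫⁻ D, f D ∂(Measure.pi fun _ : Fin n => poolMeasure T) =
      uniformAverage fun J : Fin n → Fin w => f fun t => T (J t) := by
  have := isProbabilityMeasure_count hw
  have hmap : (Measure.pi fun _ : Fin n => poolMeasure T) =
      (Measure.pi fun _ : Fin n => ((w : ℝ≥0∞)⁻¹ • (Measure.count : Measure (Fin w)))).map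
        fun J t => T (J t) :=
    (measurePreserving_pi _ _ fun _ => ⟨measurable_of_countable T, rfl⟩).map_eq.symm
  rw [hmap, lintegral_map hf (measurable_of_countable _), lintegral_fintype, uniformAverage,
    Finset.mul_sum]
  refine Finset.sum_congr rfl fun J _ => ?_
  rw [Measure.pi_singleton, mul_comm]
  congr 1
  simp [ENNReal.inv_pow]

variable {C : Set (X → Bool)} {A : Kernel (Fin n → X × Option Bool) H.carrier} {α β : ℝ}

/-- On a pool labeled by a concept, a learner run on a resampled database has small empirical
error on the whole pool. -/
theorem IsSSL.uniformAverage_le (hA : IsSSL C A α β n) (hw : 0 < w) {h : X → Bool} (hh : h ∈ C)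
    (hmh : Measurable h) (T : Fin w → X) :
    uniformAverage (fun J : Fin n → Fin w =>
      A (fullyLabeled fun t => (T (J t), h (T (J t))))
        {r | α * w < (Finset.univ.filter fun i => H.eval r (T i) ≠ h (T i)).card}) ≤
      ENNReal.ofReal β := by
  have hprob := isProbabilityMeasure_poolMeasure hw T
  have hset : {r | α < genError (poolMeasure T) h (H.eval r)} =
      {r | α * w < (Finset.univ.filter fun i => H.eval r (T i) ≠ h (T i)).card} := by
    ext r
    have hr : Measurable (H.eval r) := H.measurable_eval.comp (measurable_const.prodMk measurable_id)
    have hw' : (0 : ℝ) < w := by exact_mod_cast hw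
    rw [Set.mem_ofPred_eq, Set.mem_ofPred_eq, genError_poolMeasure T hmh hr, lt_div_iff₀ hw']
  have hms : MeasurableSet {r | α < genError (poolMeasure T) h (H.eval r)} :=
    measurableSet_lt measurable_const (measurable_genError _ hmh)
  have hmeas : Measurable fun D : Fin n → X => A (fullyLabeled fun t => (D t, h (D t)))
      {r | α < genError (poolMeasure T) h (H.eval r)} :=
    (A.measurable_coe hms).comp (measurable_fullyLabeled.comp (measurable_pi_lambda _ fun t =>
      (measurable_pi_apply t).prodMk (hmh.comp (measurable_pi_apply t))))
  have := hA h hh (poolMeasure T) hprob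
  simp only [partiallyLabeled_self] at this
  rw [lintegral_pi_poolMeasure hw T hmeas, hset] at this
  exact this

open Classical in
-- The pool is labeled by a concept that may depend on all of it. Hence the union bound over the
-- labelings `u` of the drawn points (`G₁`); for fixed `u` the undrawn points are a fresh sample for
-- the output, on which deviations hold uniformly over `C` (`G₂`).
theorem avoidsNear_resample [IsMarkovKernel A] (hm : ∀ c ∈ C, Measurable c)
    (hC : TopologicalSpace.SeparableSpace C) (hA : IsSSL C A α β n) (hw : 0 < w)
    {G₁ G₂ : ℝ≥0∞}
    (hG₁ : ∀ T : Fin n → X, ((Set.toFinite {u | Realizes C T u}).toFinset.card : ℝ≥0∞) ≤ G₁)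
    (hG₂ : ∀ J : Fin n → Fin w, ∀ T : {j // j ∉ Set.range J} ⊕ {j // j ∉ Set.range J} → X,
      ((Set.toFinite {u | Realizes C T u}).toFinset.card : ℝ≥0∞) ≤ G₂)
    (μ : Measure X) [IsProbabilityMeasure μ] (c : X → Bool) {s : ℕ} (hs : 1 ≤ s)
    (hsα : s = ⌊α * w⌋₊) {ρ ρ' : ℝ} (hρ' : 0 ≤ ρ') (hρ : 8 * (s : ℝ) ≤ ρ' * (w - n : ℝ)) :
    AvoidsNear C (resample w A) μ c {r | ρ + ρ' < genError μ c (H.eval r)} ρ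
      (ENNReal.ofReal β + G₁ * (2 * (G₂ * ENNReal.ofReal ((32 / 81) ^ s)))) := by
  have : Nonempty (Fin w) := ⟨⟨0, hw⟩⟩
  have hcard : ∀ J : Fin n → Fin w, (w - n : ℝ) ≤ Fintype.card {j // j ∉ Set.range J} := by
    intro J
    have h1 : Fintype.card {j // j ∈ Set.range J} ≤ n := by
      have := Fintype.card_le_of_surjective
        (fun t : Fin n => (⟨J t, t, rfl⟩ : {j // j ∈ Set.range J}))
        (by rintro ⟨_, t, rfl⟩; exact ⟨t, rfl⟩)
      simpa using this
    have h2 := Fintype.card_subtype_compl fun j => j ∈ Set.range J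
    have h3 := Fintype.card_subtype_le fun j => j ∈ Set.range J
    rw [Fintype.card_fin] at h2 h3
    have h4 : w ≤ Fintype.card {j // j ∉ Set.range J} + n := by omega
    have h5 : (w : ℝ) ≤ Fintype.card {j // j ∉ Set.range J} + n := by exact_mod_cast h4
    linarith
  choose E hE hdev hν using fun J : Fin n → Fin w =>
    exists_hypothesis_deviation_set (ι := {j // j ∉ Set.range J}) hm hC H (hG₂ J) μ hs
      (hρ.trans (mul_le_mul_of_nonneg_left (hcard J) hρ'))
  set γ := 2 * (G₂ * ENNReal.ofReal ((32 / 81) ^ s)) with hγ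
  let out : ∀ J : Fin n → Fin w, (Fin w → X) → {j // j ∉ Set.range J} → X := fun J T j => T j
  let ψ : (Fin n → Fin w) → (Fin n → Bool) → (Fin w → X) → ℝ≥0∞ := fun J u T =>
    if Realizes C (T ∘ J) u then
      A (fullyLabeled fun t => (T (J t), u t)) {r | (r, out J T) ∈ E J} else 0
  have hψ : ∀ J u, Measurable (ψ J u) := by
    intro J u
    have hcomp : Measurable fun T : Fin w → X => T ∘ J :=
      measurable_pi_lambda _ fun t => measurable_pi_apply (J t)
    have hdb : Measurable fun T : Fin w → X => fullyLabeled fun t => (T (J t), u t) :=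
      measurable_fullyLabeled.comp (measurable_pi_lambda _ fun t =>
        (measurable_pi_apply (J t)).prodMk measurable_const)
    have hout : Measurable (out J) := measurable_pi_lambda _ fun j => measurable_pi_apply j.1
    refine Measurable.ite (hcomp (measurableSet_realizes hm hC u)) ?_ measurable_const
    exact Kernel.measurable_kernel_prodMk_left (κ := A.comap _ hdb)
      (t := {q | (q.2, out J q.1) ∈ E J})
      ((measurable_snd.prodMk (hout.comp measurable_fst)) (hE J))
  have hψint : ∀ J, ∫⁻ T, ∑ u, ψ J u T ∂(Measure.pi fun _ : Fin w => μ) ≤ G₁ * γ := by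
    intro J
    let e := MeasurableEquiv.piEquivPiSubtypeProd (fun _ : Fin w => X) fun j => j ∈ Set.range J
    have hpres := (measurePreserving_piEquivPiSubtypeProd (fun _ : Fin w => μ)
      fun j => j ∈ Set.range J).symm
    have hmeas : Measurable fun T => ∑ u, ψ J u T := Finset.measurable_sum _ fun u _ => hψ J u
    have hmeas' : Measurable fun z : ({j // j ∈ Set.range J} → X) ×
        ({j // j ∉ Set.range J} → X) => ∑ u, ψ J u (e.symm z) := hmeas.comp e.symm.measurable
    rw [← hpres.lintegral_comp hmeas, lintegral_prod _ hmeas'.aemeasurable]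
    have hinner : ∀ V : {j // j ∈ Set.range J} → X,
        ∫⁻ V', ∑ u, ψ J u (e.symm (V, V')) ∂(Measure.pi fun _ => μ) ≤ G₁ * γ := by
      intro V
      let D : Fin n → X := fun t => V ⟨J t, t, rfl⟩
      have hD : ∀ V' t, e.symm (V, V') (J t) = D t := by
        intro V' t
        have : J t ∈ Set.range J := ⟨t, rfl⟩
        simp [e, D, MeasurableEquiv.piEquivPiSubtypeProd, Equiv.piEquivPiSubtypeProd]
      have hout : ∀ V', out J (e.symm (V, V')) = V' := by
        intro V'
        funext j
        have := j.2
        simp only [out, e, MeasurableEquiv.piEquivPiSubtypeProd, Equiv.piEquivPiSubtypeProd]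
        exact dif_neg this
      have hψV : ∀ (u : Fin n → Bool) V', ψ J u (e.symm (V, V')) =
          if Realizes C D u then
            A (fullyLabeled fun t => (D t, u t)) {r | (r, V') ∈ E J} else 0 := by
        intro u V'
        have : e.symm (V, V') ∘ J = D := funext (hD V')
        simp only [ψ, this, hout, hD]
      -- The database `(D, u)` does not involve `V'`, so output and undrawn points are independent
      -- and Fubini applies.
      have hterm : ∀ u : Fin n → Bool, ∫⁻ V', A (fullyLabeled fun t => (D t, u t)) {r | (r, V') ∈ E J}
          ∂(Measure.pi fun _ => μ) ≤ γ := by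
        intro u
        set a := A (fullyLabeled fun t => (D t, u t))
        calc _ = (a.prod (Measure.pi fun _ : {j // j ∉ Set.range J} => μ)) (E J) :=
              (Measure.prod_apply_symm (hE J)).symm
          _ = ∫⁻ r, (Measure.pi fun _ : {j // j ∉ Set.range J} => μ) (Prod.mk r ⁻¹' E J) ∂a :=
              Measure.prod_apply (hE J)
          _ ≤ ∫⁻ _, γ ∂a := lintegral_mono fun r => hν J r
          _ = γ := by rw [lintegral_const, measure_univ, mul_one]
      simp only [hψV]
      rw [lintegral_finsetSum']
      · calc _ ≤ ∑ u : Fin n → Bool, if Realizes C D u then γ else 0 := by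
              refine Finset.sum_le_sum fun u _ => ?_
              split_ifs
              · exact hterm u
              · simp
          _ = (Set.toFinite {u | Realizes C D u}).toFinset.card * γ := by
              rw [← Finset.sum_filter, Finset.sum_const, nsmul_eq_mul]
              congr 3
              ext u
              simp
          _ ≤ G₁ * γ := by
              gcongr
              exact hG₁ D
      · intro u _
        have h1 : Measurable fun V' => ψ J u (e.symm (V, V')) :=
          (hψ J u).comp (e.symm.measurable.comp measurable_prodMk_left)
        simp only [hψV] at h1
        exact h1.aemeasurable
    refine (lintegral_mono hinner).trans_eq ?_
    rw [lintegral_const, measure_univ, mul_one]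
  have hΨ : Measurable fun T : Fin w → X => uniformAverage fun J : Fin n → Fin w => ∑ u, ψ J u T :=
    (Finset.measurable_sum _ fun J _ => Finset.measurable_sum _ fun u _ => hψ J u).const_mul _
  refine ⟨fun q => ENNReal.ofReal β + uniformAverage fun J : Fin n → Fin w => ∑ u, ψ J u q.1,
    measurable_const.add (hΨ.comp measurable_fst), fun T U h hh hρh => ?_, ?_⟩
  · rw [resample_apply]
    refine le_trans ?_ (add_le_add_left (hA.uniformAverage_le hw hh (hm h hh) T) _)
    rw [← uniformAverage_add]
    refine uniformAverage_mono fun J => ?_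
    refine le_trans ?_ (add_le_add_right (Finset.single_le_sum (f := fun u => ψ J u T)
      (fun _ _ => zero_le) (Finset.mem_univ (h ∘ T ∘ J))) _)
    have hψh : ψ J (h ∘ T ∘ J) T =
        A (fullyLabeled fun t => (T (J t), h (T (J t)))) {r | (r, out J T) ∈ E J} :=
      if_pos (realizes_comp hh (T ∘ J))
    simp only [hψh]
    refine le_trans (measure_mono fun r hr => ?_) (measure_union_le _ _)
    rw [Set.mem_union]
    by_contra! hcon
    simp only [Set.mem_ofPred_eq, not_lt] at hcon hr
    -- Outside both bad events, `r` errs on at most `⌊α w⌋` pool entries, a fortiori on so many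
    -- undrawn ones.
    refine absurd (hdev J r (out J T) hcon.2 h hh ?_) (not_le.2 ?_)
    · rw [hsα]
      refine le_trans ?_ (Nat.le_floor hcon.1)
      refine Finset.card_le_card_of_injOn (fun j => j.1) (fun j hj => ?_)
        (Subtype.val_injective.injOn)
      simpa [out] using hj
    · have := genError_triangle (μ := μ) c h (H.eval r)
      linarith
  · rw [lintegral_add_left measurable_const, lintegral_const, measure_univ, mul_one]
    gcongr
    have hΨ' : Measurable fun q : (Fin w → X) × (Empty → X) =>
        uniformAverage fun J : Fin n → Fin w => ∑ u, ψ J u q.1 := hΨ.comp measurable_fst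
    rw [lintegral_prod _ hΨ'.aemeasurable]
    simp only [lintegral_const, measure_univ, mul_one]
    simp only [uniformAverage]
    rw [lintegral_const_mul _ (Finset.measurable_sum _ fun J _ =>
      Finset.measurable_sum _ fun u _ => hψ J u),
      lintegral_finsetSum _ fun J _ => Finset.measurable_sum _ fun u _ => hψ J u]
    exact uniformAverage_le hψint

end ResampleAccuracy

/-! ### Active learning with random coins and nonadaptive queries -/

section Nonadaptive

variable {X : Type u} [MeasurableSpace X] {H : HypothesisSpace.{u, v} X} {N m : ℕ}
theorem ActiveAlgorithm.lintegral_stateAfter_succ (A : ActiveAlgorithm X H N)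
    {g : A.State × Option Bool → A.State} (hg : Measurable g)
    (hstep : A.step = Kernel.deterministic g hg) (S : Fin N → X × Bool) (k : ℕ)
    {f : A.State → ℝ≥0∞} (hf : Measurable f) :
    ∫⁻ s, f s ∂(A.stateAfter (k + 1) S) =
      ∫⁻ s, f (g (s, A.answer (S, s))) ∂(A.stateAfter k S) := by
  have : ∀ k, IsSFiniteKernel (A.stateAfter k) := by
    intro k
    induction k with
    | zero => rw [ActiveAlgorithm.stateAfter]; infer_instance
    | succ k ih => rw [ActiveAlgorithm.stateAfter]; infer_instance
  rw [ActiveAlgorithm.stateAfter, Kernel.lintegral_comp _ _ _ hf,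
    Kernel.lintegral_id_prod hf.lintegral_kernel]
  simp only [hstep, Kernel.comap_apply, Kernel.lintegral_deterministic' _ hf]

theorem ActiveAlgorithm.lintegral_stateAfter_eq_uniformAverage {Ω : Type*} [Fintype Ω]
    (A : ActiveAlgorithm X H N) {g : A.State × Option Bool → A.State} (hg : Measurable g)
    (hstep : A.step = Kernel.deterministic g hg) (S : Fin N → X × Bool) (st : ℕ → Ω → A.State)
    (hinit : ∀ f : A.State → ℝ≥0∞, Measurable f →
      ∫⁻ s, f s ∂(A.init fun i => (S i).1) = uniformAverage fun ω => f (st 0 ω))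
    (hst : ∀ k ω, g (st k ω, A.answer (S, st k ω)) = st (k + 1) ω) (k : ℕ)
    {f : A.State → ℝ≥0∞} (hf : Measurable f) :
    ∫⁻ s, f s ∂(A.stateAfter k S) = uniformAverage fun ω => f (st k ω) := by
  induction k generalizing f with
  | zero => rw [ActiveAlgorithm.stateAfter, Kernel.comap_apply, hinit f hf]
  | succ k ih =>
    have hmeas : Measurable fun s => f (g (s, A.answer (S, s))) :=
      hf.comp (hg.comp (measurable_id.prodMk (A.measurable_answer.comp measurable_prodMk_left)))
    rw [A.lintegral_stateAfter_succ hg hstep S k hf, ih hmeas]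
    simp only [hst]

variable {Ω : Type} [Fintype Ω] [Nonempty Ω] [MeasurableSpace Ω] [DiscreteMeasurableSpace Ω]

/-- The state of the nonadaptive algorithm: pool, coins, round, and answers so far. -/
abbrev CoinState (X : Type u) (Ω : Type) (N m : ℕ) : Type u :=
  (Fin N → X) × Ω × ℕ × (Fin m → Bool)

/-- Record an answer and proceed to the next round. -/
def coinNext (q : CoinState X Ω N m × Option Bool) : CoinState X Ω N m :=
  (q.1.1, q.1.2.1, q.1.2.2.1 + 1,
    -- In `coinAlgorithm` the default `false` is never recorded: an answer is missing only in rounds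
    -- `≥ m`, which match no `j`.
    fun j : Fin m => if (j : ℕ) = q.1.2.2.1 then q.2.getD false else q.1.2.2.2 j)

theorem measurable_coinNext :
    Measurable (coinNext : CoinState X Ω N m × Option Bool → CoinState X Ω N m) := by
  have h : Measurable fun p : (Ω × ℕ × (Fin m → Bool)) × Option Bool =>
      (p.1.1, p.1.2.1 + 1,
        fun j : Fin m => if (j : ℕ) = p.1.2.1 then p.2.getD false else p.1.2.2 j) :=
    measurable_of_countable _
  exact measurable_fst.fst.prodMk (h.comp (measurable_fst.snd.prodMk measurable_snd))

/-- The initial state: uniform coins and no answers. -/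
noncomputable def coinInit : Kernel (Fin N → X) (CoinState X Ω N m) where
  toFun P := (Fintype.card Ω : ℝ≥0∞)⁻¹ • ∑ ω : Ω, Measure.dirac (P, ω, 0, fun _ => false)
  measurable' := by
    refine Measure.measurable_of_measurable_coe _ fun F hF => ?_
    simp only [Measure.smul_apply, Measure.coe_finsetSum, Finset.sum_apply, smul_eq_mul]
    refine (Finset.measurable_sum _ fun ω _ => ?_).const_mul _
    exact (Measure.measurable_coe hF).comp (Measure.measurable_dirac.comp
      (measurable_id.prodMk measurable_const))

theorem lintegral_coinInit (P : Fin N → X) {f : CoinState X Ω N m → ℝ≥0∞} (hf : Measurable f) :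
    ∫⁻ s, f s ∂(coinInit P) = uniformAverage fun ω : Ω => f (P, ω, 0, fun _ => false) := by
  change ∫⁻ s, f s ∂((Fintype.card Ω : ℝ≥0∞)⁻¹ •
    ∑ ω : Ω, Measure.dirac ((P, ω, 0, fun _ => false) : CoinState X Ω N m)) = _
  rw [lintegral_smul_measure, lintegral_finsetSum_measure]
  simp only [uniformAverage, smul_eq_mul, lintegral_dirac' _ hf]

instance isMarkovKernel_coinInit :
    IsMarkovKernel (coinInit : Kernel (Fin N → X) (CoinState X Ω N m)) := by
  refine ⟨fun P => ⟨?_⟩⟩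
  rw [← lintegral_one, lintegral_coinInit P measurable_const, uniformAverage_const]

/-- Draw coins `ω`, query the pool entries `Q ω 0, …, Q ω (m - 1)`, and draw the output from the
coins, the pool and the answers. -/
noncomputable def coinAlgorithm (Q : Ω → Fin m → Fin N)
    (out : Kernel (Ω × (Fin N → X) × (Fin m → Bool)) H.carrier) [IsMarkovKernel out] :
    ActiveAlgorithm X H N where
  State := CoinState X Ω N m
  init := coinInit
  query s := if h : s.2.2.1 < m then some (Q s.2.1 ⟨s.2.2.1, h⟩) else none
  step := Kernel.deterministic coinNext measurable_coinNext
  output := out.comap (fun s => (s.2.1, s.1, s.2.2.2))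
    (measurable_snd.fst.prodMk (measurable_fst.prodMk measurable_snd.snd.snd))
  measurable_query := by
    have h : Measurable fun p : Ω × ℕ =>
        (if h : p.2 < m then some (Q p.1 ⟨p.2, h⟩) else none : Option (Fin N)) :=
      measurable_of_countable _
    exact h.comp (measurable_snd.fst.prodMk measurable_snd.snd.fst)
  markov_init := inferInstance
  markov_step := inferInstance
  markov_output := inferInstance

variable (Q : Ω → Fin m → Fin N) (out : Kernel (Ω × (Fin N → X) × (Fin m → Bool)) H.carrier)
  [IsMarkovKernel out]

theorem run_coinAlgorithm (S : Fin N → X × Bool) {F : Set H.carrier} (hF : MeasurableSet F) :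
    (coinAlgorithm (H := H) Q out).run m S F =
      uniformAverage fun ω => out (ω, fun i => (S i).1, fun j => (S (Q ω j)).2) F := by
  rw [ActiveAlgorithm.run, Kernel.comp_apply' _ _ _ hF]
  have := (coinAlgorithm (H := H) Q out).lintegral_stateAfter_eq_uniformAverage
    (measurable_coinNext (X := X) (Ω := Ω) (N := N) (m := m)) rfl S
    (fun k ω => (fun i => (S i).1, ω, k, fun j => if (j : ℕ) < k then (S (Q ω j)).2 else false))
    (fun f hf => lintegral_coinInit (m := m) (fun i => (S i).1) hf)
    (fun k ω => by
      refine Prod.ext rfl (Prod.ext rfl (Prod.ext rfl (funext fun j => ?_)))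
      by_cases hj : (j : ℕ) = k
      · subst hj
        simp [coinNext, coinAlgorithm, ActiveAlgorithm.answer]
      · have : (j : ℕ) < k + 1 ↔ (j : ℕ) < k := by omega
        simp [coinNext, hj, this])
    m (((coinAlgorithm (H := H) Q out).output).measurable_coe hF)
  rw [this]
  simp only [Fin.is_lt, if_true]
  rfl

end Nonadaptive

/-! ### Privacy amplification by choosing among candidates -/

section Amplification

variable {X : Type u} [MeasurableSpace X] {H : HypothesisSpace.{u, v} X} {m : ℕ}
variable {κ : Type} [Fintype κ] [DecidableEq κ]

/-- A mechanism on a labeled and an unlabeled pool, each of whose examples is chosen at random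
among `b` candidates, as an active learner that queries the labels of the labeled pool. -/
theorem existsPAL_of_mechanism {C : Set (X → Bool)} (hm : ∀ c ∈ C, Measurable c)
    (B : Kernel ((Fin m → X × Bool) × (κ → X)) H.carrier) [IsMarkovKernel B]
    {α β ε δ : ℝ} {Λ δ' : ℝ≥0∞} (hL : LabeledStable B Λ δ') (hU : UnlabeledStable B Λ δ')
    (hβ : 0 ≤ β) (hε : 0 ≤ ε) {b : ℕ} (hb : 2 ≤ b) (hΛ : Λ ≤ ENNReal.ofReal ε * (b - 1 : ℕ))
    (hδ : δ' * (b : ℝ≥0∞)⁻¹ ≤ ENNReal.ofReal δ)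
    (hacc : ∀ c ∈ C, ∀ μ : Measure X, IsProbabilityMeasure μ →
      ∫⁻ q : (Fin m → X) × (κ → X), B (fun i => (q.1 i, c (q.1 i)), q.2)
        {r | α < genError μ c (H.eval r)}
        ∂((Measure.pi fun _ => μ).prod (Measure.pi fun _ => μ)) ≤ ENNReal.ofReal β) :
    ExistsPAL.{u, v} C α β ε δ ((m + Fintype.card κ) * b) m := by
  set N := (m + Fintype.card κ) * b with hN
  have hbpos : 0 < b := by omega
  have : Nonempty (Fin b) := ⟨⟨0, hbpos⟩⟩
  -- The pool is split into disjoint groups of `b` candidates, one group per example of `B`.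
  -- Disjointness makes each selection injective, so the selected examples are again i.i.d.
  let e : (Fin m ⊕ κ) × Fin b ≃ Fin N := Fintype.equivFinOfCardEq (by simp [hN])
  let sel : ((Fin m ⊕ κ) → Fin b) → Fin m ⊕ κ → Fin N := fun ω s => e (s, ω s)
  have hsel : ∀ ω, Function.Injective (sel ω) := fun ω s t h =>
    congrArg Prod.fst (e.injective h)
  let f : ((Fin m ⊕ κ) → Fin b) × (Fin N → X) × (Fin m → Bool) →
      (Fin m → X × Bool) × (κ → X) := fun p =>
    (fun i => (p.2.1 (sel p.1 (Sum.inl i)), p.2.2 i), fun k => p.2.1 (sel p.1 (Sum.inr k)))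
  have hf : Measurable f := by
    refine measurable_from_prod_countable_right fun ω => ?_
    refine Measurable.prodMk (measurable_pi_lambda _ fun i => ?_) (measurable_pi_lambda _ fun k => ?_)
    · exact ((measurable_pi_apply (sel ω (Sum.inl i))).comp measurable_fst).prodMk
        ((measurable_pi_apply i).comp measurable_snd)
    · exact (measurable_pi_apply (sel ω (Sum.inr k))).comp measurable_fst
  let A := coinAlgorithm (H := H) (fun ω j => sel ω (Sum.inl j)) (B.comap f hf)
  let Φ : Set H.carrier → (Fin m ⊕ κ → X × Bool) → ℝ≥0∞ := fun F a =>
    B (a ∘ Sum.inl, fun k => (a (Sum.inr k)).1) F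
  have hrun : ∀ S F, MeasurableSet F →
      A.run m S F = uniformAverage fun ω : Fin m ⊕ κ → Fin b =>
        Φ F fun s => S (e (s, ω s)) :=
    fun S F hF => run_coinAlgorithm _ _ S hF
  have hΦ : ∀ F, MeasurableSet F → OneEntryStable (Φ F) Λ δ' := by
    rintro F hF a a' (i | k) h
    · have : (fun k => (a (Sum.inr k)).1) = fun k => (a' (Sum.inr k)).1 :=
        funext fun k => by rw [h _ (by simp)]
      simp only [Φ, this]
      exact hL _ _ _ i (fun j hj => h _ (by simpa using hj)) F hF
    · have : a ∘ Sum.inl = a' ∘ Sum.inl := funext fun i => h _ (by simp)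
      simp only [Φ, this]
      exact hU _ _ _ k (fun j hj => by rw [h _ (by simpa using hj)]) F hF
  refine ⟨H, A, fun c hc μ hμ => ?_, fun S S' hS F hF => ?_⟩
  · have hgm : Measurable fun r : H.carrier => genError μ c (H.eval r) :=
      measurable_genError μ (hm c hc)
    have hbad : MeasurableSet {r : H.carrier | α < genError μ c (H.eval r)} :=
      measurableSet_lt measurable_const hgm
    have hgood : {r : H.carrier | genError μ c (H.eval r) ≤ α} =
        {r | α < genError μ c (H.eval r)}ᶜ := by ext; simp
    set bad := {r : H.carrier | α < genError μ c (H.eval r)}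
    have hcm : Measurable fun D : Fin N → X => fun i => (D i, c (D i)) :=
      measurable_pi_lambda _ fun i =>
        (measurable_pi_apply i).prodMk ((hm c hc).comp (measurable_pi_apply i))
    have hpairm : Measurable fun q : (Fin m → X) × (κ → X) =>
        (fun i => (q.1 i, c (q.1 i)), q.2) := by
      refine Measurable.prodMk (measurable_pi_lambda _ fun i => ?_) measurable_snd
      exact ((measurable_pi_apply i).comp measurable_fst).prodMk
        ((hm c hc).comp ((measurable_pi_apply i).comp measurable_fst))
    have hΨ : Measurable fun q : (Fin m → X) × (κ → X) =>
        B (fun i => (q.1 i, c (q.1 i)), q.2) bad := (B.measurable_coe hbad).comp hpairm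
    have hterm : ∀ ω : Fin m ⊕ κ → Fin b, MeasurePreserving
        (fun D : Fin N → X => (MeasurableEquiv.sumPiEquivProdPi fun _ : Fin m ⊕ κ => X)
          (D ∘ sel ω)) (Measure.pi fun _ => μ)
          ((Measure.pi fun _ => μ).prod (Measure.pi fun _ => μ)) := fun ω =>
      (measurePreserving_sumPiEquivProdPi fun _ : Fin m ⊕ κ => μ).comp
        (measurePreserving_comp_of_injective μ (hsel ω))
    have hfail : ∫⁻ D, A.run m (fun i => (D i, c (D i))) bad ∂(Measure.pi fun _ => μ) ≤
        ENNReal.ofReal β := by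
      have hω : ∀ ω : Fin m ⊕ κ → Fin b,
          ∫⁻ D : Fin N → X, Φ bad (fun s => (D (e (s, ω s)), c (D (e (s, ω s)))))
            ∂(Measure.pi fun _ => μ) ≤ ENNReal.ofReal β := by
        intro ω
        refine le_trans (le_of_eq ?_) (hacc c hc μ hμ)
        exact (hterm ω).lintegral_comp hΨ
      simp only [hrun _ _ hbad]
      simp only [uniformAverage]
      have hmeas : ∀ ω : Fin m ⊕ κ → Fin b, Measurable fun D : Fin N → X =>
          Φ bad (fun s => (D (e (s, ω s)), c (D (e (s, ω s))))) :=
        fun ω => hΨ.comp (hterm ω).measurable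
      rw [lintegral_const_mul _ (Finset.measurable_sum _ fun ω _ => hmeas ω),
        lintegral_finsetSum _ fun ω _ => hmeas ω]
      exact uniformAverage_le hω
    have hmk : IsMarkovKernel (A.run m) := by
      have : ∀ k, IsMarkovKernel (A.stateAfter k) := by
        intro k
        induction k with
        | zero => rw [ActiveAlgorithm.stateAfter]; infer_instance
        | succ k ih => rw [ActiveAlgorithm.stateAfter]; infer_instance
      rw [ActiveAlgorithm.run]
      infer_instance
    have hsum : ∫⁻ D, A.run m (fun i => (D i, c (D i))) badᶜ ∂(Measure.pi fun _ => μ) +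
        ∫⁻ D, A.run m (fun i => (D i, c (D i))) bad ∂(Measure.pi fun _ => μ) = 1 := by
      have h1 : Measurable fun D : Fin N → X => A.run m (fun i => (D i, c (D i))) badᶜ :=
        ((A.run m).measurable_coe hbad.compl).comp hcm
      rw [← lintegral_add_left h1]
      have : ∀ D : Fin N → X, A.run m (fun i => (D i, c (D i))) badᶜ +
          A.run m (fun i => (D i, c (D i))) bad = 1 := fun D => by
        rw [add_comm]; exact prob_add_prob_compl hbad
      simp only [this, lintegral_const, measure_univ, mul_one]
    rw [hgood]
    rw [ENNReal.ofReal_sub _ hβ, ENNReal.ofReal_one, ← hsum]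
    exact tsub_le_iff_right.2 (add_le_add_right hfail _)
  · obtain ⟨i, hi, huniq⟩ := hS
    rw [hrun S F hF, hrun S' F hF]
    obtain ⟨⟨t, j⟩, rfl⟩ := e.surjective i
    -- The changed entry is one candidate of one group, so one application with `κ = ε` suffices,
    -- and `1 + ε ≤ exp ε`.
    refine (uniformAverage_pi_le_of_eq_off (hΦ F hF) (by simpa using hb) (by simpa using hΛ)
      (fun s j => S (e (s, j))) (fun s j => S' (e (s, j))) t j fun t' j' h => ?_).trans
      (add_le_add ?_ ?_)
    · by_contra hne
      have := e.injective (huniq _ hne)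
      simp only [Prod.mk.injEq] at this
      exact h.elim (· this.1) (· this.2)
    · gcongr
      rw [← ENNReal.ofReal_one, ← ENNReal.ofReal_add zero_le_one hε]
      exact ENNReal.ofReal_le_ofReal (by linarith [Real.add_one_le_exp ε])
    · simpa using hδ

end Amplification

/-! ### Sample sizes -/

section Numerics

theorem exists_pow_mul_mem_Icc {m n : ℕ} (hm : 0 < m) (hmn : m ≤ 8 * n) :
    ∃ k, 2 * n ≤ 4 ^ k * m ∧ 4 ^ k * m ≤ 8 * n := by
  classical
  have hex : ∃ k, 2 * n ≤ 4 ^ k * m :=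
    ⟨2 * n, (Nat.lt_pow_self (by norm_num)).le.trans (Nat.le_mul_of_pos_right _ hm)⟩
  refine ⟨Nat.find hex, Nat.find_spec hex, ?_⟩
  rcases h : Nat.find hex with _ | k
  · simpa using hmn
  · have := Nat.find_min hex (m := k) (by omega)
    have h4 : 4 ^ (k + 1) * m = 4 * (4 ^ k * m) := by ring
    omega

/-- The parameters of the relabeling scheme: `s = ⌈128 d L⌉` and `m = ⌈s / α⌉`, where
`L = log (1 / (α β))`. -/
structure SchemeParameters (α β : ℝ) (d s m : ℕ) : Prop where
  α_pos : 0 < α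
  α_le : α ≤ 1
  β_pos : 0 < β
  β_le : β ≤ 1
  one_le_log : 1 ≤ Real.log (1 / (α * β))
  one_le_d : 1 ≤ d
  s_eq : s = ⌈128 * d * Real.log (1 / (α * β))⌉₊
  m_eq : m = ⌈s / α⌉₊

namespace SchemeParameters

variable {α β : ℝ} {d s m : ℕ} (h : SchemeParameters α β d s m)
include h

theorem le_s : 128 * d * Real.log (1 / (α * β)) ≤ s := by
  rw [h.s_eq]; exact Nat.le_ceil _

theorem one_le_mul_log : 1 ≤ d * Real.log (1 / (α * β)) := by
  have := h.one_le_log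
  have hd : (1 : ℝ) ≤ d := by exact_mod_cast h.one_le_d
  nlinarith

theorem s_le : (s : ℝ) ≤ 256 * (d * Real.log (1 / (α * β))) := by
  have h1 := h.one_le_mul_log
  have : (s : ℝ) < 128 * d * Real.log (1 / (α * β)) + 1 := by
    rw [h.s_eq]; exact Nat.ceil_lt_add_one (by nlinarith)
  nlinarith

theorem one_le_s : 1 ≤ s := by
  have h1 := h.one_le_mul_log
  have h2 := h.le_s
  have : (1 : ℝ) ≤ s := by nlinarith
  exact_mod_cast this

theorem s_le_mul_m : (s : ℝ) ≤ α * m := by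
  have : (s : ℝ) / α ≤ m := by rw [h.m_eq]; exact Nat.le_ceil _
  rwa [div_le_iff₀ h.α_pos, mul_comm] at this

theorem m_le : (m : ℝ) ≤ 512 * (d * Real.log (1 / (α * β))) / α := by
  have hs : (1 : ℝ) ≤ s := by exact_mod_cast h.one_le_s
  have h1 : 1 ≤ s / α := by
    rw [le_div_iff₀ h.α_pos]; linarith [h.α_le]
  have h2 : (m : ℝ) < s / α + 1 := by
    rw [h.m_eq]; exact Nat.ceil_lt_add_one (by linarith)
  calc (m : ℝ) ≤ 2 * (s / α) := by linarith
    _ ≤ 2 * (256 * (d * Real.log (1 / (α * β))) / α) := by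
        have := h.α_pos
        gcongr
        exact h.s_le
    _ = _ := by ring

theorem d_le_m : d ≤ m := by
  have h1 := h.le_s
  have h2 := h.s_le_mul_m
  have h3 := h.one_le_log
  have hd : (1 : ℝ) ≤ d := by exact_mod_cast h.one_le_d
  have : (d : ℝ) ≤ m := by
    calc (d : ℝ) ≤ 128 * d * Real.log (1 / (α * β)) := by nlinarith
      _ ≤ α * m := h1.trans h2
      _ ≤ 1 * m := by gcongr; exact h.α_le
      _ = m := one_mul _
  exact_mod_cast this

/-- The base of the growth bound is at most `exp (9 + 2 i + 2 L)`, where `5 * 4 ^ i * m` is the size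
of two consecutive pools. As `s ≥ 128 d L`, the decay is `exp (-64 * 2 ^ i * d L)`, and `2 ^ i ≥ 1 +
i` makes it win for all `i` with room for `β / 2 ^ i`. -/
theorem growth_sq_mul_le (i : ℕ) :
    3 * ((Real.exp 1 * (5 * (4 ^ i * m)) / d) ^ d) ^ 2 * (1 / 2) ^ (2 ^ i * s) ≤ β / 2 ^ i := by
  set L := Real.log (1 / (α * β)) with hL
  have hα := h.α_pos
  have hβ := h.β_pos
  have hL1 : 1 ≤ L := h.one_le_log
  have hd1 : (1 : ℝ) ≤ d := by exact_mod_cast h.one_le_d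
  have hLsplit : L = Real.log (1 / α) + Real.log (1 / β) := by
    rw [hL, ← Real.log_mul (by positivity) (by positivity)]; congr 1; field_simp
  have hlogα : 0 ≤ Real.log (1 / α) := Real.log_nonneg (by rw [le_div_iff₀ hα]; linarith [h.α_le])
  have hlogβ : 0 ≤ Real.log (1 / β) := Real.log_nonneg (by rw [le_div_iff₀ hβ]; linarith [h.β_le])
  have hexpα : 1 / α ≤ Real.exp L := by
    calc 1 / α = Real.exp (Real.log (1 / α)) := (Real.exp_log (by positivity)).symm
      _ ≤ _ := Real.exp_le_exp.2 (by linarith)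
  have hexpβ : 1 / β ≤ Real.exp L := by
    calc 1 / β = Real.exp (Real.log (1 / β)) := (Real.exp_log (by positivity)).symm
      _ ≤ _ := Real.exp_le_exp.2 (by linarith)
  have hexpL : L ≤ Real.exp L := by linarith [Real.add_one_le_exp L]
  have he : (2.7 : ℝ) ≤ Real.exp 1 := by linarith [Real.exp_one_gt_d9]
  have he' : Real.exp 1 ≤ 2.72 := by linarith [Real.exp_one_lt_d9]
  have hconst : Real.exp 1 * (5 * 512) ≤ Real.exp 9 := by
    calc Real.exp 1 * (5 * 512) ≤ 2.72 * (5 * 512) := by gcongr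
      _ ≤ 2.7 ^ 9 := by norm_num
      _ ≤ Real.exp 1 ^ 9 := by gcongr
      _ = Real.exp 9 := by rw [← Real.exp_nat_mul]; norm_num
  have h4 : (4 : ℝ) ^ i ≤ Real.exp (2 * i) := by
    calc (4 : ℝ) ^ i ≤ (Real.exp 1 ^ 2) ^ i := by gcongr; nlinarith
      _ = Real.exp (2 * i) := by rw [← pow_mul, ← Real.exp_nat_mul]; push_cast; ring_nf
  have hbase : Real.exp 1 * (5 * (4 ^ i * m)) / d ≤ Real.exp (9 + 2 * i + 2 * L) := by
    have hd0 : (0 : ℝ) < d := by linarith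
    calc Real.exp 1 * (5 * (4 ^ i * m)) / d
        ≤ Real.exp 1 * (5 * (4 ^ i * (512 * (d * L) / α))) / d := by
          gcongr
          exact h.m_le
      _ = (Real.exp 1 * (5 * 512)) * 4 ^ i * (L * (1 / α)) := by field_simp
      _ ≤ Real.exp 9 * Real.exp (2 * i) * (Real.exp L * Real.exp L) := by gcongr
      _ = _ := by rw [← Real.exp_add, ← Real.exp_add, ← Real.exp_add]; ring_nf
  have hgrowth : ((Real.exp 1 * (5 * (4 ^ i * m)) / d) ^ d) ^ 2 ≤
      Real.exp (2 * d * (9 + 2 * i + 2 * L)) := by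
    calc ((Real.exp 1 * (5 * (4 ^ i * m)) / d) ^ d) ^ 2
        ≤ ((Real.exp (9 + 2 * i + 2 * L)) ^ d) ^ 2 := by gcongr
      _ = _ := by rw [← pow_mul, ← Real.exp_nat_mul]; push_cast; ring_nf
  have hhalf : (1 / 2 : ℝ) ^ (2 ^ i * s) ≤ Real.exp (-(64 * 2 ^ i * (d * L))) := by
    have h12 : (1 / 2 : ℝ) ≤ Real.exp (-(1 / 2)) := by
      linarith [Real.add_one_le_exp (-(1 / 2 : ℝ))]
    calc (1 / 2 : ℝ) ^ (2 ^ i * s) ≤ Real.exp (-(1 / 2)) ^ (2 ^ i * s) := by gcongr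
      _ = Real.exp (-(2 ^ i * s / 2)) := by
          rw [← Real.exp_nat_mul]; push_cast; ring_nf
      _ ≤ _ := by
          refine Real.exp_le_exp.2 (neg_le_neg ?_)
          have := h.le_s
          have h2 : (0 : ℝ) < 2 ^ i := by positivity
          nlinarith
  have h3 : (3 : ℝ) ≤ Real.exp 2 := by
    calc (3 : ℝ) ≤ 2.7 ^ 2 := by norm_num
      _ ≤ Real.exp 1 ^ 2 := by gcongr
      _ = Real.exp 2 := by rw [← Real.exp_nat_mul]; norm_num
  have hrhs : Real.exp (-(L + i)) ≤ β / 2 ^ i := by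
    have h2i : (2 : ℝ) ^ i ≤ Real.exp i := by
      calc (2 : ℝ) ^ i ≤ Real.exp 1 ^ i := by gcongr; linarith
        _ = Real.exp i := by rw [← Real.exp_nat_mul, mul_one]
    rw [Real.exp_neg, Real.exp_add, inv_le_comm₀ (by positivity) (by positivity), inv_div]
    calc 2 ^ i / β = 1 / β * 2 ^ i := by ring
      _ ≤ _ := by gcongr
  refine le_trans ?_ hrhs
  calc _ ≤ Real.exp 2 * Real.exp (2 * d * (9 + 2 * i + 2 * L)) *
        Real.exp (-(64 * 2 ^ i * (d * L))) := by gcongr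
    _ = Real.exp (2 + 2 * d * (9 + 2 * i + 2 * L) - 64 * 2 ^ i * (d * L)) := by
        rw [← Real.exp_add, ← Real.exp_add]; ring_nf
    _ ≤ _ := by
        refine Real.exp_le_exp.2 ?_
        have hi0 : (0 : ℝ) ≤ i := Nat.cast_nonneg i
        have h2i : (1 : ℝ) + i ≤ 2 ^ i := by
          have : i + 1 ≤ 2 ^ i := Nat.lt_pow_self (by norm_num)
          have : ((i + 1 : ℕ) : ℝ) ≤ ((2 ^ i : ℕ) : ℝ) := by exact_mod_cast this
          push_cast at this
          linarith
        have hdL : 1 ≤ d * L := h.one_le_mul_log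
        have h5 : (d : ℝ) ≤ d * L := by nlinarith
        have h6 : L ≤ d * L := by nlinarith
        have h7 : 64 * (1 + (i : ℝ)) * (d * L) ≤ 64 * 2 ^ i * (d * L) := by gcongr
        have h8 : (d : ℝ) * i ≤ d * L * i := by gcongr
        have h9 : (i : ℝ) ≤ d * L * i := by nlinarith
        nlinarith

end SchemeParameters

end Numerics

/-! ### The relabeling scheme -/

section Scheme

variable {X : Type u} [MeasurableSpace X] {H : HypothesisSpace.{u, v} X}

theorem LabeledStable.mono {R : Type*} [MeasurableSpace R] {ι κ : Type*}
    [Fintype ι] [Fintype κ] {B : Kernel ((ι → X × Bool) × (κ → X)) R} {Λ Λ' δ δ' : ℝ≥0∞}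
    (h : LabeledStable B Λ δ) (hΛ : Λ ≤ Λ') (hδ : δ ≤ δ') : LabeledStable B Λ' δ' :=
  fun S S' U i hS F hF => (h S S' U i hS F hF).trans (by gcongr)

theorem AvoidsNear.mono {R : Type*} [MeasurableSpace R] {ι κ : Type*} [Fintype ι] [Fintype κ]
    {C : Set (X → Bool)} {B : Kernel ((ι → X × Bool) × (κ → X)) R} {μ : Measure X}
    {c : X → Bool} {bad : Set R} {ρ : ℝ} {β β' : ℝ≥0∞}
    (h : AvoidsNear C B μ c bad ρ β) (hβ : β ≤ β') : AvoidsNear C B μ c bad ρ β' := by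
  obtain ⟨Ψ, h1, h2, h3⟩ := h
  exact ⟨Ψ, h1, h2, h3.trans hβ⟩

/-- The two failures of one relabeling step: the sample deviates, or the Gibbs draw has too many
disagreements. -/
theorem SchemeParameters.ofReal_failure_le {α β : ℝ} {d s m : ℕ}
    (h : SchemeParameters α β d s m) (i : ℕ) {G : ℝ≥0∞}
    (hG : G = ENNReal.ofReal ((Real.exp 1 * (5 * (4 ^ i * m)) / d) ^ d)) :
    2 * (G * G * ENNReal.ofReal ((32 / 81) ^ (2 ^ i * s))) + G * 2⁻¹ ^ (2 ^ i * s) ≤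
      ENNReal.ofReal (β / 2 ^ i) := by
  set g := (Real.exp 1 * (5 * (4 ^ i * (m : ℝ))) / d) ^ d with hg
  have hd0 : (0 : ℝ) < d := by exact_mod_cast h.one_le_d
  have hg1 : 1 ≤ g := by
    refine one_le_pow₀ ?_
    rw [le_div_iff₀ hd0, one_mul]
    have h1 : (d : ℝ) ≤ m := by exact_mod_cast h.d_le_m
    have h4 : (1 : ℝ) ≤ 4 ^ i := one_le_pow₀ (by norm_num)
    have he : 1 ≤ Real.exp 1 := Real.one_le_exp zero_le_one
    have h5 : (m : ℝ) ≤ 5 * (4 ^ i * m) := by nlinarith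
    nlinarith
  have hhalf : (2⁻¹ : ℝ≥0∞) ^ (2 ^ i * s) = ENNReal.ofReal ((1 / 2) ^ (2 ^ i * s)) := by
    rw [ENNReal.ofReal_pow (by norm_num), one_div, ENNReal.ofReal_inv_of_pos (by norm_num),
      ENNReal.ofReal_ofNat]
  have h2 : (2 : ℝ≥0∞) = ENNReal.ofReal 2 := (ENNReal.ofReal_ofNat 2).symm
  rw [hhalf, hG, ← ENNReal.ofReal_mul (by positivity), ← ENNReal.ofReal_mul (by positivity),
    ← ENNReal.ofReal_mul (by positivity), h2, ← ENNReal.ofReal_mul (by positivity),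
    ← ENNReal.ofReal_add (by positivity) (by positivity)]
  refine ENNReal.ofReal_le_ofReal (le_trans ?_ (h.growth_sq_mul_le i))
  rw [← hg]
  have hx : ((32 : ℝ) / 81) ^ (2 ^ i * s) ≤ (1 / 2) ^ (2 ^ i * s) :=
    pow_le_pow_left₀ (by norm_num) (by norm_num) _
  set y := ((1 : ℝ) / 2) ^ (2 ^ i * s)
  have hy : 0 ≤ y := by positivity
  have h1 : g * g * (32 / 81) ^ (2 ^ i * s) ≤ g * g * y := by gcongr
  have h2 : g * y ≤ g * g * y := by
    gcongr
    nlinarith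
  nlinarith

/-- The first pool of `4 ^ i * m` examples is labeled; exponentially growing pools are relabeled
one after the other, and the learner is run on examples resampled from the last pool. -/
theorem exists_relabeling_mechanism {C : Set (X → Bool)} (hm : ∀ c ∈ C, Measurable c)
    (hC : TopologicalSpace.SeparableSpace C) (hne : C.Nonempty) {α β δ : ℝ} {d s m n k : ℕ}
    (hd : vcDimension C ≤ d) (h : SchemeParameters α β d s m)
    (A : Kernel (Fin n → X × Option Bool) H.carrier) [IsMarkovKernel A]
    (hA : IsSSL C A α β n) (hpriv : IsDifferentiallyPrivate A 1 δ) (hn : 0 < n)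
    (hnk : 2 * n ≤ 4 ^ k * m) (i : ℕ) (hik : i ≤ k) :
    ∃ (κ : Type) (_ : Fintype κ) (_ : DecidableEq κ)
      (B : Kernel ((Fin (4 ^ i * m) → X × Bool) × (κ → X)) H.carrier),
      -- The geometric series of the pool sizes `4 ^ j * m` for `i < j ≤ k`.
      3 * Fintype.card κ + 4 * (4 ^ i * m) ≤ 4 * (4 ^ k * m) ∧ IsMarkovKernel B ∧
      LabeledStable B 21 (21 * ENNReal.ofReal δ) ∧
      UnlabeledStable B (16 * 21) (21 * ENNReal.ofReal δ) ∧
      ∀ c ∈ C, ∀ μ : Measure X, IsProbabilityMeasure μ →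
        -- The radius is the sum of `8 α / 2 ^ j` over the steps `j < i` already made; the learner
        -- has at least `16 α` left. The failure bound is `β` for the learner plus the sum of `β / 2
        -- ^ j` over `j ≥ i`.
        AvoidsNear C B μ c {r | 32 * α < genError μ c (H.eval r)} (16 * α * (1 - 1 / 2 ^ i))
          (ENNReal.ofReal (β + 2 * β / 2 ^ i)) := by
  classical
  have hα := h.α_pos
  have hβ := h.β_pos
  have hd0 : (0 : ℝ) < d := by exact_mod_cast h.one_le_d
  have hs_le : ∀ j, ((2 ^ j * s : ℕ) : ℝ) ≤ α / 2 ^ j * (4 ^ j * m : ℕ) := by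
    intro j
    have h4 : (4 : ℝ) ^ j = 2 ^ j * 2 ^ j := by rw [← mul_pow]; norm_num
    have := h.s_le_mul_m
    push_cast
    rw [h4]
    calc (2 : ℝ) ^ j * s ≤ 2 ^ j * (α * m) := by gcongr
      _ = _ := by field_simp
  have hdm : ∀ j, (d : ℝ) ≤ 5 * (4 ^ j * m) := by
    intro j
    have h1 : (d : ℝ) ≤ m := by exact_mod_cast h.d_le_m
    have h4 : (1 : ℝ) ≤ 4 ^ j := one_le_pow₀ (by norm_num)
    nlinarith
  induction hj : k - i generalizing i with
  | zero =>
    obtain rfl : i = k := by omega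
    set w := 4 ^ i * m with hw
    have hnw : 2 * n ≤ w := hnk
    have hw0 : 0 < w := by omega
    have hwR : (0 : ℝ) < w := by exact_mod_cast hw0
    set G := ENNReal.ofReal ((Real.exp 1 * (5 * (4 ^ i * m)) / d) ^ d) with hG
    have hcast : ((w : ℕ) : ℝ) = 4 ^ i * m := by simp [hw]
    refine ⟨Empty, inferInstance, inferInstance, resample w A, by simp, isMarkovKernel_resample hw0 A,
      labeledStable_resample hpriv (by omega) hnw, unlabeledStable_empty _ _ _,
      fun c hc μ hμ => ?_⟩
    have hG₁ : ∀ T : Fin n → X,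
        ((Set.toFinite {u | Realizes C T u}).toFinset.card : ℝ≥0∞) ≤ G := fun T => by
      refine card_realizes_le_ofReal hd h.one_le_d (hdm i) ?_ T
      rw [Fintype.card_fin, ← hcast]
      have : (2 * n : ℝ) ≤ w := by exact_mod_cast hnw
      have : (0 : ℝ) ≤ n := Nat.cast_nonneg n
      linarith
    have hG₂ : ∀ J : Fin n → Fin w, ∀ T : {j // j ∉ Set.range J} ⊕ {j // j ∉ Set.range J} → X,
        ((Set.toFinite {u | Realizes C T u}).toFinset.card : ℝ≥0∞) ≤ G := fun J T => by
      refine card_realizes_le_ofReal hd h.one_le_d (hdm i) ?_ T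
      have h1 := Fintype.card_subtype_le fun j => j ∉ Set.range J
      rw [Fintype.card_fin] at h1
      have h2 : (Fintype.card {j // j ∉ Set.range J} : ℝ) ≤ w := by exact_mod_cast h1
      rw [Fintype.card_sum, ← hcast]
      push_cast
      linarith
    have hfloor : 2 ^ i * s ≤ ⌊α * w⌋₊ := by
      refine Nat.le_floor ((hs_le i).trans ?_)
      gcongr
      exact div_le_self hα.le (one_le_pow₀ (by norm_num))
    have h2i : (0 : ℝ) < 1 / 2 ^ i := by positivity
    -- At least `w / 2` entries are not drawn, so `8 ⌊α w⌋` errors among them correspond to the rate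
    -- `16 α`.
    have hρ' : 16 * α ≤ 32 * α - 16 * α * (1 - 1 / 2 ^ i) := by nlinarith
    have hbase := avoidsNear_resample hm hC hA hw0 hG₁ hG₂ μ c
      (hfloor.trans' (Nat.mul_pos (by positivity) h.one_le_s)) rfl
      (ρ := 16 * α * (1 - 1 / 2 ^ i)) (ρ' := 32 * α - 16 * α * (1 - 1 / 2 ^ i))
      (by linarith) (by
        have h1 : (⌊α * w⌋₊ : ℝ) ≤ α * w := Nat.floor_le (by positivity)
        have h2 : (2 * n : ℝ) ≤ w := by exact_mod_cast hnw
        calc 8 * (⌊α * w⌋₊ : ℝ) ≤ 16 * α * (w / 2) := by nlinarith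
          _ ≤ 16 * α * (w - n) := by gcongr; linarith
          _ ≤ _ := by gcongr; linarith)
    rw [add_sub_cancel] at hbase
    refine hbase.mono ?_
    rw [ENNReal.ofReal_add hβ.le (by positivity)]
    gcongr
    calc G * (2 * (G * ENNReal.ofReal ((32 / 81) ^ ⌊α * w⌋₊)))
        ≤ G * (2 * (G * ENNReal.ofReal ((32 / 81) ^ (2 ^ i * s)))) := by
          have : ((32 : ℝ) / 81) ^ ⌊α * w⌋₊ ≤ (32 / 81) ^ (2 ^ i * s) :=
            pow_le_pow_of_le_one (by norm_num) (by norm_num) hfloor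
          exact mul_le_mul_right (mul_le_mul_right (mul_le_mul_right
            (ENNReal.ofReal_le_ofReal this) _) _) _
      _ = 2 * (G * G * ENNReal.ofReal ((32 / 81) ^ (2 ^ i * s))) := by ring
      _ ≤ _ := le_self_add.trans (h.ofReal_failure_le i hG)
      _ ≤ _ := by
          refine ENNReal.ofReal_le_ofReal ?_
          gcongr
          linarith
  | succ j ih =>
    obtain ⟨κ, hκ, hκ', B, hcard, hB, hL, hU, hacc⟩ := ih (i + 1) (by omega) (by omega)
    refine ⟨Fin (4 ^ (i + 1) * m) ⊕ κ, inferInstance, inferInstance,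
      gibbsStep (ι := Fin (4 ^ i * m)) hm hC B, ?_, isMarkovKernel_gibbsStep hm hC hne,
      (labeledStable_gibbsStep hm hC hne).mono (by norm_num) zero_le,
      unlabeledStable_gibbsStep hm hC hne hL hU, fun c hc μ hμ => ?_⟩
    · rw [Fintype.card_sum, Fintype.card_fin]
      have : 4 ^ (i + 1) * m = 4 * (4 ^ i * m) := by ring
      omega
    · set G := ENNReal.ofReal ((Real.exp 1 * (5 * (4 ^ i * m)) / d) ^ d) with hG
      have hm0 : (0 : ℝ) ≤ 4 ^ i * m := by positivity
      have hdev := exists_pair_deviation_set (ι := Fin (4 ^ i * m)) hm hC (G := G)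
        (fun T => card_realizes_le_ofReal hd h.one_le_d (hdm i) (by
          rw [Fintype.card_sum, Fintype.card_fin]; push_cast; linarith) T) μ
        (s := 2 ^ i * s) (Nat.mul_pos (by positivity) h.one_le_s) (ρ := 8 * α / 2 ^ i) (by
          rw [Fintype.card_fin]
          calc 8 * ((2 ^ i * s : ℕ) : ℝ) ≤ 8 * (α / 2 ^ i * (4 ^ i * m : ℕ)) := by
                gcongr; exact hs_le i
            _ = _ := by ring)
      have hρ : 16 * α * (1 - 1 / 2 ^ i) + 8 * α / 2 ^ i = 16 * α * (1 - 1 / 2 ^ (i + 1)) := by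
        rw [pow_succ]; field_simp; ring
      have hstep := avoidsNear_gibbsStep (ι := Fin (4 ^ i * m)) hm hC (B := B) (μ := μ) (c := c)
        (s := 2 ^ i * s) (G := G) (ρ := 16 * α * (1 - 1 / 2 ^ i))
        (fun T => card_realizes_le_ofReal hd h.one_le_d (hdm i) (by
          rw [Fintype.card_sum, Fintype.card_fin, Fintype.card_fin, pow_succ]
          push_cast; linarith) T) hdev (hρ ▸ hacc c hc μ hμ)
      refine hstep.mono ((add_le_add_left (h.ofReal_failure_le i hG) _).trans_eq ?_)
      rw [← ENNReal.ofReal_add (by positivity) (by positivity)]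
      congr 1
      rw [pow_succ]; field_simp; ring

end Scheme

/-! ### The two degenerate constructions and the main theorem -/

section Main

variable {X : Type u} [MeasurableSpace X]

theorem existsPAL_zero {C : Set (X → Bool)} (hm : ∀ c ∈ C, Measurable c) {h₀ : X → Bool}
    (h₀m : Measurable h₀) {α β ε δ : ℝ} (hβ : 0 ≤ β) (hε : 0 ≤ ε)
    (h : ∀ c ∈ C, ∀ μ : Measure X, IsProbabilityMeasure μ → genError μ c h₀ ≤ α ∨ 1 ≤ β) :
    ExistsPAL.{u, v} C α β ε δ 0 0 := by
  let H : HypothesisSpace.{u, v} X :=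
    { carrier := PUnit
      eval := fun _ => h₀
      measurable_eval := h₀m.comp measurable_snd }
  let B : Kernel ((Fin 0 → X × Bool) × (Empty → X)) H.carrier :=
    Kernel.const _ (Measure.dirac PUnit.unit)
  have hP := existsPAL_of_mechanism (H := H) (κ := Empty) hm B (α := α) (β := β) (ε := ε) (δ := δ)
    (Λ := 0) (δ' := 0) (b := 2) (fun _ _ _ i => i.elim0) (unlabeledStable_empty _ _ _) hβ hε le_rfl
    zero_le (by simp) fun c hc μ hμ => by
      rcases h c hc μ hμ with h1 | h1
      · have : {r : H.carrier | α < genError μ c (H.eval r)} = ∅ := by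
          ext r
          simp only [Set.mem_ofPred_eq, Set.mem_empty_iff_false, iff_false, not_lt]
          exact h1
        simp [this]
      · calc _ ≤ ∫⁻ _ : (Fin 0 → X) × (Empty → X), 1
              ∂((Measure.pi fun _ => μ).prod (Measure.pi fun _ => μ)) :=
              lintegral_mono fun _ => prob_le_one
          _ = 1 := by simp
          _ ≤ _ := by rw [← ENNReal.ofReal_one]; exact ENNReal.ofReal_le_ofReal h1
  simpa using hP

/-- Without relabeling, amplification alone suffices; this serves when `n` labels are affordable,
namely for `n ≤ m` or infinite VC dimension. -/
theorem existsPAL_of_query_all {C : Set (X → Bool)} (hm : ∀ c ∈ C, Measurable c)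
    {H : HypothesisSpace.{u, v} X} {n : ℕ} (A : Kernel (Fin n → X × Option Bool) H.carrier)
    [IsMarkovKernel A] {α α' β β' ε δ : ℝ} (hα : α ≤ α') (hβ : β ≤ β') (hβ' : 0 ≤ β')
    (hA : IsSSL C A α β n) (hpriv : IsDifferentiallyPrivate A 1 δ) (hε : 0 ≤ ε) {b : ℕ}
    (hb : 2 ≤ b) (hΛ : 336 ≤ ENNReal.ofReal ε * (b - 1 : ℕ)) :
    ExistsPAL.{u, v} C α' β' ε δ (n * b) n := by
  let B : Kernel ((Fin n → X × Bool) × (Empty → X)) H.carrier :=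
    A.comap (fun q => fullyLabeled q.1) (measurable_fullyLabeled.comp measurable_fst)
  have hL : LabeledStable B (ENNReal.ofReal (Real.exp 1)) (ENNReal.ofReal δ) :=
    fun S S' U i hS F hF => hpriv.oneEntryStable zero_le_one hF S S' i hS
  have he : ENNReal.ofReal (Real.exp 1) ≤ 336 := by
    rw [← ENNReal.ofReal_ofNat 336]
    exact ENNReal.ofReal_le_ofReal (by linarith [Real.exp_one_lt_d9])
  have hP := existsPAL_of_mechanism (κ := Empty) hm B (α := α') (β := β') (ε := ε) (δ := δ) hL
    (unlabeledStable_empty _ _ _) hβ' hε hb (he.trans hΛ)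
    (mul_le_of_le_one_right zero_le (ENNReal.inv_le_one.2 (by exact_mod_cast (by omega : 1 ≤ b))))
    fun c hc μ hμ => by
      have hmeas : Measurable fun q : (Fin n → X) × (Empty → X) =>
          A (fullyLabeled fun i => (q.1 i, c (q.1 i))) {r | α < genError μ c (H.eval r)} := by
        refine (A.measurable_coe (measurableSet_lt measurable_const
          (measurable_genError μ (hm c hc)))).comp (measurable_fullyLabeled.comp
            (measurable_pi_lambda _ fun i => ?_))
        exact ((measurable_pi_apply i).comp measurable_fst).prodMk
          ((hm c hc).comp ((measurable_pi_apply i).comp measurable_fst))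
      calc _ ≤ ∫⁻ q : (Fin n → X) × (Empty → X),
            A (fullyLabeled fun i => (q.1 i, c (q.1 i))) {r | α < genError μ c (H.eval r)}
            ∂((Measure.pi fun _ => μ).prod (Measure.pi fun _ => μ)) :=
            lintegral_mono fun q => measure_mono fun r (hr : α' < _) => hα.trans_lt hr
        _ = ∫⁻ D : Fin n → X, A (fullyLabeled fun i => (D i, c (D i)))
            {r | α < genError μ c (H.eval r)} ∂(Measure.pi fun _ => μ) := by
            rw [lintegral_prod _ hmeas.aemeasurable]
            simp only [lintegral_const, measure_univ, mul_one]
        _ ≤ ENNReal.ofReal β := by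
            have := hA c hc μ hμ
            simpa only [partiallyLabeled_self] using this
        _ ≤ _ := ENNReal.ofReal_le_ofReal hβ
  simpa using hP

theorem subsingleton_of_vcDimension_eq_zero {C : Set (X → Bool)} (h : vcDimension C = 0) :
    C.Subsingleton := by
  classical
  intro c hc c' hc'
  by_contra hne
  obtain ⟨x, hx⟩ := Function.ne_iff.1 hne
  have := card_le_of_shatteredBy (C := C) (d := 0) (by simpa using h.le) (B := {x}) fun f => by
    by_cases hf : c x = f x
    · exact ⟨c, hc, by simpa using hf⟩
    · refine ⟨c', hc', ?_⟩
      simp only [Finset.mem_singleton, forall_eq]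
      revert hx hf
      cases c x <;> cases c' x <;> cases f x <;> simp
  simp at this

end Main

theorem mainTheorem4 :
    ∃ lam a b : ℝ, 0 < lam ∧ 0 < a ∧ 0 < b ∧
      ∀ (X : Type u) [MeasurableSpace X] (C : Set (X → Bool)),
        (∀ c ∈ C, Measurable c) → TopologicalSpace.SeparableSpace C →
        ∀ (α β ε δ : ℝ) (n : ℕ), 0 < α → α ≤ 1 → 0 < β → β ≤ 1 → 0 < ε → ε ≤ 1 → 0 ≤ δ →
          ExistsPSSL.{u, v} C α β 1 δ n n →
          ∃ N m : ℕ,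
            (N : ℝ) ≤ a * (n / ε) ∧
            (m : ℝ≥0∞) ≤ ENNReal.ofReal (b * (1 / α * Real.log (1 / (α * β)))) *
              (vcDimension C : ℝ≥0∞) ∧
            ExistsPAL.{u, v} C (lam * α) (lam * β) ε δ N m := by
  -- `3718 = 11 * 338`: at most `11 n` examples, each with at most `338 / ε` candidates.
  refine ⟨32, 3718, 512, by norm_num, by norm_num, by norm_num, ?_⟩
  intro X _ C hm hC α β ε δ n hα hα1 hβ hβ1 hε hε1 hδ ⟨H, A, hA, hssl, hpriv⟩
  have htriv : ∀ h₀ : X → Bool, Measurable h₀ → (∀ c ∈ C, ∀ μ : Measure X,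
      IsProbabilityMeasure μ → genError μ c h₀ ≤ 32 * α ∨ 1 ≤ 32 * β) → ∃ N m : ℕ,
            (N : ℝ) ≤ 3718 * (n / ε) ∧
            (m : ℝ≥0∞) ≤ ENNReal.ofReal (512 * (1 / α * Real.log (1 / (α * β)))) *
              (vcDimension C : ℝ≥0∞) ∧
            ExistsPAL.{u, v} C (32 * α) (32 * β) ε δ N m := fun h₀ h₀m h =>
    ⟨0, 0, by simp; positivity, by simp, existsPAL_zero hm h₀m (by positivity) hε.le h⟩
  -- Apart from this trivial case `α` and `β` are below `1 / 32`, which gives `L ≥ 1`.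
  by_cases hlarge : 1 ≤ 32 * α ∨ 1 ≤ 32 * β
  · refine htriv (fun _ => false) measurable_const fun c _ μ hμ => ?_
    exact hlarge.imp_left fun h => measureReal_le_one.trans h
  push Not at hlarge
  have hlog : 1 ≤ Real.log (1 / (α * β)) := by
    rw [Real.le_log_iff_exp_le (by positivity), le_div_iff₀ (by positivity)]
    have := Real.exp_one_lt_d9
    have := Real.exp_pos 1
    nlinarith [mul_pos hα hβ]
  -- `336 = 16 * 21` is the stability factor of the relabeling mechanism.
  set b := ⌈336 / ε⌉₊ + 1 with hb
  have hbε : (336 : ℝ) ≤ ε * (b - 1 : ℕ) := by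
    have := Nat.le_ceil (336 / ε)
    rw [div_le_iff₀ hε] at this
    rw [hb, Nat.add_sub_cancel, mul_comm]
    exact this
  have hΛ : 336 ≤ ENNReal.ofReal ε * (b - 1 : ℕ) := by
    rw [← ENNReal.ofReal_natCast, ← ENNReal.ofReal_mul hε.le, ← ENNReal.ofReal_ofNat 336]
    exact ENNReal.ofReal_le_ofReal hbε
  have hb336 : 336 ≤ b := by
    have : (336 : ℝ) ≤ (b - 1 : ℕ) := hbε.trans (mul_le_of_le_one_left (Nat.cast_nonneg _) hε1)
    have : 336 ≤ b - 1 := by exact_mod_cast this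
    omega
  have hble : (b : ℝ) ≤ 338 / ε := by
    have h1 : (⌈336 / ε⌉₊ : ℝ) < 336 / ε + 1 := Nat.ceil_lt_add_one (by positivity)
    have h2 : 1 ≤ 1 / ε := by rw [le_div_iff₀ hε]; linarith
    have h3 : 338 / ε = 336 / ε + 2 * (1 / ε) := by ring
    rw [hb, h3]
    push_cast
    linarith
  have hN : ∀ M : ℕ, M ≤ 11 * n → ((M * b : ℕ) : ℝ) ≤ 3718 * (n / ε) := by
    intro M hM
    have hM' : (M : ℝ) ≤ 11 * n := by exact_mod_cast hM
    push_cast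
    calc (M : ℝ) * b ≤ (11 * n) * (338 / ε) := by gcongr
      _ = _ := by ring
  have hall : ExistsPAL.{u, v} C (32 * α) (32 * β) ε δ (n * b) n :=
    existsPAL_of_query_all hm A (by linarith) (by linarith) (by linarith) hssl hpriv hε.le
      (by omega) hΛ
  by_cases hvc : vcDimension C = ⊤
  · refine ⟨n * b, n, hN n (by omega), ?_, hall⟩
    have hpos : ENNReal.ofReal (512 * (1 / α * Real.log (1 / (α * β)))) ≠ 0 := by
      have : 0 < Real.log (1 / (α * β)) := by linarith
      simp only [ne_eq, ENNReal.ofReal_eq_zero, not_le]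
      positivity
    rw [hvc, ENat.toENNReal_top, ENNReal.mul_top hpos]
    exact le_top
  obtain ⟨d, hvc⟩ := ENat.ne_top_iff_exists.1 hvc
  replace hvc := hvc.symm
  rcases Nat.eq_zero_or_pos d with rfl | hd
  · have hsub := subsingleton_of_vcDimension_eq_zero (by simpa using hvc)
    rcases C.eq_empty_or_nonempty with rfl | ⟨c, hc⟩
    · exact htriv (fun _ => false) measurable_const fun c hc => hc.elim
    · refine htriv c (hm c hc) fun c' hc' μ hμ => Or.inl ?_
      rw [hsub hc' hc]
      simp only [genError, ne_eq, not_true_eq_false, Set.ofPred_false, measureReal_empty]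
      positivity
  have hne : C.Nonempty := by
    rw [Set.nonempty_iff_ne_empty]
    rintro rfl
    have : vcDimension (∅ : Set (X → Bool)) = 0 := by simp [vcDimension, ShatteredBy]
    rw [this] at hvc
    have : (0 : ℕ) = d := by exact_mod_cast hvc
    omega
  set s := ⌈128 * d * Real.log (1 / (α * β))⌉₊ with hs
  set m := ⌈s / α⌉₊ with hmdef
  have hpar : SchemeParameters α β d s m := ⟨hα, hα1, hβ, hβ1, hlog, hd, hs, hmdef⟩
  have hmbound : ∀ m' : ℕ, m' ≤ m → (m' : ℝ≥0∞) ≤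
      ENNReal.ofReal (512 * (1 / α * Real.log (1 / (α * β)))) * (vcDimension C : ℝ≥0∞) := by
    intro m' hm'
    have hcast : ((d : ℕ∞) : ℝ≥0∞) = ENNReal.ofReal d := by simp
    rw [hvc, hcast, ← ENNReal.ofReal_mul' (Nat.cast_nonneg _), ← ENNReal.ofReal_natCast]
    refine ENNReal.ofReal_le_ofReal ?_
    calc (m' : ℝ) ≤ m := by exact_mod_cast hm'
      _ ≤ _ := hpar.m_le
      _ = _ := by ring
  rcases le_or_gt n m with hnm | hnm
  · exact ⟨n * b, n, hN n (by omega), hmbound n hnm, hall⟩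
  obtain ⟨k, hk1, hk2⟩ := exists_pow_mul_mem_Icc (m := m) (n := n)
    (hpar.one_le_d.trans hpar.d_le_m) (by omega)
  obtain ⟨κ, _, _, B, hcard, hB, hL, hU, hacc⟩ := exists_relabeling_mechanism hm hC hne
    hvc.le hpar A hssl hpriv (by omega) hk1 0 (Nat.zero_le k)
  have hP := existsPAL_of_mechanism hm B (α := 32 * α) (β := 32 * β) (ε := ε) (δ := δ)
    (Λ := 16 * 21) (δ' := 21 * ENNReal.ofReal δ) (b := b) (hL.mono (by norm_num : (21 : ℝ≥0∞) ≤ 16 * 21) le_rfl) hU (by linarith) hε.le (by omega)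
    (le_trans (by norm_num) hΛ) (by
      calc 21 * ENNReal.ofReal δ * (b : ℝ≥0∞)⁻¹ ≤ b * ENNReal.ofReal δ * (b : ℝ≥0∞)⁻¹ := by
            gcongr
            exact_mod_cast (by omega : 21 ≤ b)
        _ = (b * (b : ℝ≥0∞)⁻¹) * ENNReal.ofReal δ := by ring
        _ ≤ 1 * ENNReal.ofReal δ := by
            gcongr
            exact ENNReal.mul_inv_le_one _
        _ = _ := one_mul _) fun c hc μ hμ => by
      obtain ⟨Ψ, hΨ, hle, hint⟩ := hacc c hc μ hμ
      -- For `i = 0` the radius is 0 and the target itself labels the pool; the failure bound is `3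
      -- β`.
      refine (lintegral_mono fun q : (Fin (4 ^ 0 * m) → X) × (κ → X) => hle q.1 q.2 c hc ?_).trans (hint.trans ?_)
      · simp [genError]
      · refine ENNReal.ofReal_le_ofReal ?_
        norm_num
        linarith
  refine ⟨_, _, hN _ ?_, hmbound _ ?_, hP⟩
  -- All pools together have at most `(4 / 3) * 4 ^ k * m ≤ (32 / 3) n` examples.
  · simp only [pow_zero, one_mul] at hcard ⊢
    omega
  · simp
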